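/- Let $\mathcal X\subset\mathbb R$ be an interval and let $(F_x)_{x\in\mathcal X}$ be distribution functions on $\mathbb R$ such that $x\mapsto F_x(y)$ is non-increasing on $\mathcal X$ for every $y\in\mathbb R$. For a distribution function $G$ and $\beta\in(0,1)$ put $G^{-1}(\beta)=\min\{y: G(y)\ge\beta\}$ and $G^{-1}(\beta+)=\inf\{y: G(y)>\beta\}$. For $\beta\in(0,1)$ let $Q_x(\beta)\in[F_x^{-1}(\beta),F_x^{-1}(\beta+)]$ be a $\beta$-quantile of $F_x$, non-decreasing in $x\in\mathcal X$. For each $n\ge2$ let $(X_{n1},Y_{n1}),\dots,(X_{nn},Y_{nn})$ be random pairs with $X_{ni}\in\mathcal X$ such that, conditionally on $\boldsymbol X_n=(X_{ni})_{i=1}^n$, the variables $Y_{n1},\dots,Y_{nn}$ are independent with $\mathbb P(Y_{ni}\le y\mid \boldsymbol X_n)=F_{X_{ni}}(y)$. For each $y$ let $\widehat F_{n\,\cdot}(y)$ denote the antitonic least squares estimator, i.e. the unique function $h$ on the set $\{X_{n1},\dots,X_{nn}\}$ that minimizes $\sum_{i=1}^n(1_{[Y_{ni}\le y]}-h(X_{ni}))^2$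 among all non-increasing functions. A plug-in quantile estimator is a family $(\widehat Q_{nx})_{x\in\mathcal X}$ such that for every $\beta\in(0,1)$ the function $x\mapsto\widehat Q_{nx}(\beta)$ is non-decreasing on $\mathcal X$ and $\widehat F_{nx}^{-1}(\beta)\le\widehat Q_{nx}(\beta)\le\widehat F_{nx}^{-1}(\beta+)$ for every $x\in\{X_{n1},\dots,X_{nn}\}$. Let $x_o$ be an interior point of $\mathcal X$, let $\alpha\in(0,1]$, $C_1,C_2,C_3,\kappa>0$ and $0\le\beta_1<\beta_2\le1$, and assume: (A'.1) there is a neighbourhood $U\subset\mathcal X$ of $x_o$ such that $\sup_{y\in\mathbb R}|F_x(y)-F_{x_o}(y)|\le C_1|x-x_o|^\alpha$ for all $x\in U$; (A'.2) with $\delta_n=C_3n^{-1/(2\alpha+1)}$, the probability that each of the intervals $[x_o-\delta_n,x_o]$ and $[x_o,x_o+\delta_n]$ contains at least $C_2n\delta_n$ of the points $X_{n1},\dots,X_{nn}$ (counted with multiplicity) tends to $1$ as $n\to\infty$; (A'.3) $F_{x_o}(y_2)-F_{x_o}(y_1)\ge\kappa(y_2-y_1)$ for all real $y_1<y_2$ with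 $F_{x_o}(y_1),F_{x_o}(y_2-)\in(\beta_1,\beta_2)$. Then, for any plug-in quantile estimator, $\sup_{\beta\in B_n}|\widehat Q_{nx_o}(\beta)-Q_{x_o}(\beta)|=O_p(n^{-\alpha/(2\alpha+1)})$ with $B_n=(\beta_1+\Delta_n,\beta_2-\Delta_n)$ and $\Delta_n=O(n^{-\alpha/(2\alpha+1)})$, where the implied constant in $\Delta_n$ may, like the one in $O_p$, depend on the prescribed error probability. That is: for every $\varepsilon>0$ there are constants $C,M>0$ and $N$ such that, with $\Delta_n=Cn^{-\alpha/(2\alpha+1)}$ and for all $n\ge N$, $$\mathbb P\Bigl(\sup_{\beta\in(\beta_1+\Delta_n,\ \beta_2-\Delta_n)}\bigl|\widehat Q_{nx_o}(\beta)-Q_{x_o}(\beta)\bigr|>M\,n^{-\alpha/(2\alpha+1)}\Bigr)\le\varepsilon .$$ -/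

import Mathlib

open MeasureTheory ProbabilityTheory Filter Set
open scoped Topology

/-- `G` is a distribution function on the real line. -/
structure IsDistributionFunction (G : ℝ → ℝ) : Prop where
  mono : Monotone G
  rightCont : ∀ y, ContinuousWithinAt G (Ici y) y
  atBot : Tendsto G atBot (𝓝 0)
  atTop : Tendsto G atTop (𝓝 1)

/-- The minimal `β`-quantile `G⁻¹(β) = min {y : G y ≥ β}`. -/
noncomputable def minQuantile (G : ℝ → ℝ) (β : ℝ) : ℝ := sInf {y | β ≤ G y}

/-- The maximal `β`-quantile `G⁻¹(β+) = inf {y : G y > β}`. -/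
noncomputable def maxQuantile (G : ℝ → ℝ) (β : ℝ) : ℝ := sInf {y | β < G y}

/-- A family `(F x)`, `x ∈ S`, of distribution functions, increasing in `x` with respect to
the stochastic order. -/
structure IsStochasticallyOrdered (S : Set ℝ) (F : ℝ → ℝ → ℝ) : Prop where
  distr : ∀ x ∈ S, IsDistributionFunction (F x)
  anti : ∀ y, AntitoneOn (fun x => F x y) S

/-- `Q x β` is a `β`-quantile of `F x` for all `x ∈ S` and `β ∈ (0,1)`, isotonic in `x`. -/
structure IsQuantileFamily (S : Set ℝ) (F Q : ℝ → ℝ → ℝ) : Prop where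
  quantile : ∀ x ∈ S, ∀ β ∈ Ioo (0 : ℝ) 1,
    minQuantile (F x) β ≤ Q x β ∧ Q x β ≤ maxQuantile (F x) β
  mono : ∀ β ∈ Ioo (0 : ℝ) 1, MonotoneOn (fun x => Q x β) S

/-- The σ-algebra generated by the covariate vector `(X 0, …, X (n-1))`. -/
abbrev covariateSigma {Ω : Type*} {n : ℕ} (X : Fin n → Ω → ℝ) : MeasurableSpace Ω :=
  MeasurableSpace.comap (fun ω i => X i ω) inferInstance

/-- The conditional probability `P(A | X)` of the event `A` given the covariate vector. -/
noncomputable def condProbGiven {Ω : Type*} [MeasurableSpace Ω] (P : Measure Ω) {n : ℕ}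
    (X : Fin n → Ω → ℝ) (A : Set Ω) : Ω → ℝ :=
  P[A.indicator (fun _ => (1 : ℝ)) | covariateSigma X]

/-- Observations `(X i, Y i)` with covariates in `S` such that, conditionally on `X`, the
responses `Y i` are independent with distribution functions `F (X i)`. -/
structure IsSample {Ω : Type*} [MeasurableSpace Ω] (P : Measure Ω) (S : Set ℝ)
    (F : ℝ → ℝ → ℝ) {n : ℕ} (X Y : Fin n → Ω → ℝ) : Prop where
  measX : ∀ i, Measurable (X i)
  measY : ∀ i, Measurable (Y i)
  memX : ∀ i ω, X i ω ∈ S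
  condDistr : ∀ i y,
    condProbGiven P X {ω | Y i ω ≤ y} =ᵐ[P] fun ω => F (X i ω) y
  condIndep : ∀ y : Fin n → ℝ,
    condProbGiven P X {ω | ∀ i, Y i ω ≤ y i} =ᵐ[P]
      fun ω => ∏ i, condProbGiven P X {ω' | Y i ω' ≤ y i} ω

/-- `f`, restricted to the design points, is the antitonic least squares fit to the values
`z i` observed at the design points `x i`. -/
structure IsAntitonicLS {n : ℕ} (x z : Fin n → ℝ) (f : ℝ → ℝ) : Prop where
  anti : AntitoneOn f (range x)
  minimal : ∀ h : ℝ → ℝ, AntitoneOn h (range x) →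
    ∑ i, (z i - f (x i)) ^ 2 ≤ ∑ i, (z i - h (x i)) ^ 2

/-- `G` is, at the design points, the monotone least squares estimator of the conditional
distribution functions from the data `(x i, y i)`: for each `t`, the function `G · t` is the
antitonic least squares fit to the indicators `1[y i ≤ t]`. -/
def IsDistributionEstimator {n : ℕ} (x y : Fin n → ℝ) (G : ℝ → ℝ → ℝ) : Prop :=
  ∀ t : ℝ, IsAntitonicLS x (fun i => (Iic t).indicator (fun _ => (1 : ℝ)) (y i))
    (fun u => G u t)

/-- `q` is a plug-in quantile estimator from the data `(x i, y i)`: with `G` the monotone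
least squares estimator, `q · β` is isotonic on `S` and, at each design point, lies between the
minimal and the maximal `β`-quantile of `G` there. -/
def IsPlugInQuantileEstimator (S : Set ℝ) {n : ℕ} (x y : Fin n → ℝ) (q : ℝ → ℝ → ℝ) : Prop :=
  ∃ G : ℝ → ℝ → ℝ, IsDistributionEstimator x y G ∧
    ∀ β ∈ Ioo (0 : ℝ) 1, MonotoneOn (fun u => q u β) S ∧
      ∀ i, minQuantile (G (x i)) β ≤ q (x i) β ∧ q (x i) β ≤ maxQuantile (G (x i)) β

/-- Hölder condition at `x₀`, uniformly over all `y ∈ ℝ`, on a neighbourhood of `x₀` in `S`. -/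
def HolderAtPoint (S : Set ℝ) (F : ℝ → ℝ → ℝ) (x₀ α C₁ : ℝ) : Prop :=
  ∃ U ∈ 𝓝 x₀, U ⊆ S ∧ ∀ x ∈ U, ∀ y, |F x y - F x₀ y| ≤ C₁ * |x - x₀| ^ α

/-- The number `w(B)` of design points in `B`. -/
noncomputable def designCount {n : ℕ} (x : Fin n → ℝ) (B : Set ℝ) : ℕ := {i | x i ∈ B}.ncard

/-- The bandwidth `δ_n = C₃ n^{-1/(2α+1)}`. -/
noncomputable def bandwidth (α C₃ : ℝ) (n : ℕ) : ℝ := C₃ * (n : ℝ) ^ (-(1 / (2 * α + 1)))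

/-- The design is asymptotically dense on both sides of `x₀`: the probability that each of the
intervals `[x₀ - δ_n, x₀]` and `[x₀, x₀ + δ_n]` has at least `C₂ n δ_n` design points tends
to one. -/
def DenseDesignAtPoint {Ω : ℕ → Type*} [∀ n, MeasurableSpace (Ω n)]
    (P : ∀ n, Measure (Ω n)) (X : ∀ n, Fin n → Ω n → ℝ) (x₀ α C₂ C₃ : ℝ) : Prop :=
  Tendsto (fun n : ℕ => P n {ω |
      C₂ ≤ designCount (fun i => X n i ω) (Icc (x₀ - bandwidth α C₃ n) x₀)
        / (n * bandwidth α C₃ n) ∧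
      C₂ ≤ designCount (fun i => X n i ω) (Icc x₀ (x₀ + bandwidth α C₃ n))
        / (n * bandwidth α C₃ n)})
    atTop (𝓝 1)

/-- Growth condition on a distribution function `G` between the levels `β₁` and `β₂`. -/
def GrowthCondition (G : ℝ → ℝ) (β₁ β₂ κ : ℝ) : Prop :=
  ∀ y₁ y₂ : ℝ, y₁ < y₂ → G y₁ ∈ Ioo β₁ β₂ → Function.leftLim G y₂ ∈ Ioo β₁ β₂ →
    κ * (y₂ - y₁) ≤ G y₂ - G y₁

/-- The rate `n^{-α/(2α+1)}`. -/
noncomputable def pointRate (α : ℝ) (n : ℕ) : ℝ := (n : ℝ) ^ (-(α / (2 * α + 1)))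

/-! Write `r` for `pointRate α n` and `δ` for the bandwidth. By the min-max property of antitonic
least squares, the estimator at the last design point `x k` of `[x₀ - δ, x₀]` is, for every `t`, at
most the mean of the indicators `1[y i ≤ t]` over some block of design points starting at `x₀ - δ`
and reaching at least `x k`. The block may extend far beyond `x₀`, but stochastic order bounds the
mean of its true distribution functions by `F (x₀ - δ) t`, which the Hölder condition puts within
`C₁ δ ^ α` of `F x₀ t`. The reflected argument gives a lower bound to the right of `x₀`. Isotonicity
of the plug-in quantiles transfers both bounds to `x₀`, and the growth condition turns an error `D`
in level into an error `D / κ` in the quantile (`abs_plugIn_sub_le`).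

What remains is noise: the centred block means must be at most a multiple of `r`, simultaneously in
`t` and in all blocks with at least `m = C₂ n δ` points. No logarithm may be lost.
`pi_exists_centredSum_le` achieves this: symmetrization reduces the claim to Rademacher sums over
rectangles `{y i ≤ t, g i ≤ c}`, Lévy's reflection is applied once per coordinate, Chebyshev bounds
the full sum, and dyadic peeling in the block size gives a convergent geometric series. The
resulting probability is of order `1 / (L ^ 2 * m)`, and `n δ r ^ 2 = C₃` makes it constant in `n`
for `L = K r`. Disintegration over the covariates passes from fixed to random design. -/

/-! ### Maximal inequalities for Rademacher sums, by counting sign vectors. -/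

section Rademacher

variable {ι : Type*}

/-- The sum of the signs `ε i` over `i ∈ B`. -/
def signSum (B : Finset ι) (ε : ι → ℤˣ) : ℝ := ∑ i ∈ B, ((ε i : ℤ) : ℝ)

lemma signSum_filter_of_agree (g : ι → ℝ) (B : Finset ι) {c : ℝ} {ε ε' : ι → ℤˣ}
    (h : ∀ i, g i ≤ c → ε i = ε' i) :
    signSum {i ∈ B | g i ≤ c} ε = signSum {i ∈ B | g i ≤ c} ε' := by
  refine Finset.sum_congr rfl fun i hi => ?_
  rw [h i (Finset.mem_filter.1 hi).2]

/-- The signs `ε`, reversed where `g` exceeds `c`. -/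
noncomputable def flipAbove (g : ι → ℝ) (c : ℝ) (ε : ι → ℤˣ) : ι → ℤˣ :=
  fun i => if g i ≤ c then ε i else -ε i

lemma flipAbove_agree (g : ι → ℝ) (c : ℝ) (ε : ι → ℤˣ) (i : ι) (hi : g i ≤ c) :
    flipAbove g c ε i = ε i := if_pos hi

lemma flipAbove_injective (g : ι → ℝ) (c : ℝ) : Function.Injective (flipAbove g c) := by
  intro ε ε' h
  funext i
  have := congrFun h i
  unfold flipAbove at this
  split_ifs at this
  · exact this
  · exact neg_injective this

lemma signSum_add_flipAbove (g : ι → ℝ) (c : ℝ) (ε : ι → ℤˣ) (B : Finset ι) :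
    signSum B ε + signSum B (flipAbove g c ε) = 2 * signSum {i ∈ B | g i ≤ c} ε := by
  unfold signSum flipAbove
  rw [← Finset.sum_add_distrib, Finset.sum_filter, Finset.mul_sum]
  refine Finset.sum_congr rfl fun i _ => ?_
  split_ifs
  · ring
  · push_cast; ring

lemma exists_filter_le_eq (g : ι → ℝ) (B : Finset ι) (c : ℝ)
    (h : (B.filter (g · ≤ c)).Nonempty) :
    ∃ j ∈ B, g j ≤ c ∧ B.filter (g · ≤ c) = B.filter (g · ≤ g j) := by
  obtain ⟨j, hj, hmax⟩ := Finset.exists_max_image _ g h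
  obtain ⟨hjB, hjc⟩ := Finset.mem_filter.1 hj
  refine ⟨j, hjB, hjc, Finset.filter_congr fun i hi => ⟨fun hic => ?_, fun hij => hij.trans hjc⟩⟩
  exact hmax i (Finset.mem_filter.2 ⟨hi, hic⟩)

/-- Sublevel sets are nested, so those with at most `b` elements have a largest member. It collects
the points whose own sublevel set is that small; ties in `g` may make it smaller than `b`. -/
lemma exists_filter_card_le (D : Finset ι) (g : ι → ℝ) (b : ℝ) (hb : 0 ≤ b) :
    ∃ D' ⊆ D, (D'.card : ℝ) ≤ b ∧
      ∀ c, ((D.filter (g · ≤ c)).card : ℝ) ≤ b → D.filter (g · ≤ c) = D'.filter (g · ≤ c) := by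
  classical
  refine ⟨D.filter fun i => ((D.filter (g · ≤ g i)).card : ℝ) ≤ b, Finset.filter_subset _ _,
    ?_, ?_⟩
  · rcases (D.filter fun i => ((D.filter (g · ≤ g i)).card : ℝ) ≤ b).eq_empty_or_nonempty
      with h | h
    · rw [h]; simpa using hb
    · obtain ⟨j, hj, hmax⟩ := Finset.exists_max_image _ g h
      refine le_trans ?_ (Finset.mem_filter.1 hj).2
      exact_mod_cast Finset.card_le_card fun i hi =>
        Finset.mem_filter.2 ⟨(Finset.mem_filter.1 hi).1, hmax i hi⟩
  · intro c hc
    ext i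
    simp only [Finset.mem_filter]
    refine ⟨fun ⟨hi, hic⟩ => ⟨⟨hi, le_trans ?_ hc⟩, hic⟩, fun ⟨⟨hi, _⟩, hic⟩ => ⟨hi, hic⟩⟩
    exact_mod_cast Finset.card_le_card fun k hk => Finset.mem_filter.2
      ⟨(Finset.mem_filter.1 hk).1, le_trans (Finset.mem_filter.1 hk).2 hic⟩

variable [Fintype ι] [DecidableEq ι]

open Classical in
/-- Lévy's maximal inequality for Rademacher sums over sublevel sets, uniformly over a family
of index sets. -/
lemma card_exists_sublevel_index_le (g : ι → ℝ) (𝓑 : Set (Finset ι)) (l : ℝ) :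
    Finset.card {ε : ι → ℤˣ | ∃ j, ∃ B ∈ 𝓑, l < |signSum {i ∈ B | g i ≤ g j} ε|} ≤
      2 * Finset.card {ε : ι → ℤˣ | ∃ B ∈ 𝓑, l < |signSum B ε|} := by
  set bad : (ι → ℤˣ) → ℝ → Prop :=
    fun ε c => ∃ B ∈ 𝓑, l < |signSum {i ∈ B | g i ≤ c} ε| with hbad
  set A : Finset (ι → ℤˣ) := {ε | ∃ j, bad ε (g j)} with hA
  set R : Finset (ι → ℤˣ) := {ε | ∃ B ∈ 𝓑, l < |signSum B ε|} with hR
  have hfirst : ∀ ε, ∃ c, ε ∈ A → (∃ j, c = g j) ∧ bad ε c ∧ ∀ j, bad ε (g j) → c ≤ g j := by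
    intro ε
    by_cases hε : ε ∈ A
    · obtain ⟨j₀, hj₀⟩ := (Finset.mem_filter.1 hε).2
      obtain ⟨j, hj, hmin⟩ := Finset.exists_min_image
        (Finset.univ.filter fun j => bad ε (g j)) g ⟨j₀, by simp [hj₀]⟩
      exact ⟨g j, fun _ => ⟨⟨j, rfl⟩, (Finset.mem_filter.1 hj).2,
        fun j' hj' => hmin j' (by simp [hj'])⟩⟩
    · exact ⟨0, fun h => absurd h hε⟩
  choose τ hτ using hfirst
  have hbad_congr : ∀ ε c c', c' ≤ c → (bad (flipAbove g c ε) c' ↔ bad ε c') := by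
    intro ε c c' hc
    simp only [hbad]
    have : ∀ B : Finset ι, signSum {i ∈ B | g i ≤ c'} (flipAbove g c ε) =
        signSum {i ∈ B | g i ≤ c'} ε := fun B =>
      signSum_filter_of_agree g B fun i hi => flipAbove_agree g c ε i (hi.trans hc)
    simp only [this]
  -- Reflection after the first bad level `τ ε`. Signs up to that level are kept, so `τ` is
  -- invariant under `Φ`, and `Φ` is injective on `A`. The full sums for `ε` and `Φ ε` average to
  -- the partial sum, so one of them is large.
  set Φ : (ι → ℤˣ) → (ι → ℤˣ) := fun ε => flipAbove g (τ ε) ε with hΦ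
  have hτΦ : ∀ ε ∈ A, τ (Φ ε) = τ ε := by
    intro ε hε
    obtain ⟨⟨j, hj⟩, hb, hm⟩ := hτ ε hε
    have hb' : bad (Φ ε) (g j) := by
      rw [← hj]; exact (hbad_congr ε _ _ le_rfl).2 hb
    have hΦA : Φ ε ∈ A := Finset.mem_filter.2 ⟨Finset.mem_univ _, j, hb'⟩
    obtain ⟨⟨j', hj'⟩, hb2, hm2⟩ := hτ (Φ ε) hΦA
    have h1 : τ (Φ ε) ≤ τ ε := by rw [hj]; exact hm2 j hb'
    refine le_antisymm h1 ?_
    rw [hj']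
    exact hm j' (by rw [← hj']; exact (hbad_congr ε _ _ h1).1 hb2)
  have hcover : A ⊆ R ∪ {ε ∈ A | Φ ε ∈ R} := by
    intro ε hε
    obtain ⟨-, ⟨B, hB, hlt⟩, -⟩ := hτ ε hε
    by_cases h1 : l < |signSum B ε|
    · exact Finset.mem_union_left _ (Finset.mem_filter.2 ⟨Finset.mem_univ _, B, hB, h1⟩)
    refine Finset.mem_union_right _ (Finset.mem_filter.2 ⟨hε, Finset.mem_filter.2
      ⟨Finset.mem_univ _, B, hB, ?_⟩⟩)
    have h2 := signSum_add_flipAbove g (τ ε) ε B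
    have h3 := abs_add_le (signSum B ε) (signSum B (Φ ε))
    rw [show signSum B ε + signSum B (Φ ε) = _ from h2, abs_mul, abs_two] at h3
    linarith [not_lt.1 h1]
  have hinj : Finset.card {ε ∈ A | Φ ε ∈ R} ≤ R.card := by
    refine Finset.card_le_card_of_injOn Φ (fun ε hε => (Finset.mem_filter.1 hε).2) ?_
    intro ε hε ε' hε' h
    have e1 := hτΦ ε (Finset.mem_filter.1 hε).1
    have e2 := hτΦ ε' (Finset.mem_filter.1 hε').1
    have e3 : τ ε = τ ε' := by rw [← e1, ← e2, h]
    have h' : flipAbove g (τ ε) ε = flipAbove g (τ ε') ε' := h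
    rw [← e3] at h'
    exact flipAbove_injective g _ h'
  calc A.card ≤ _ := Finset.card_le_card hcover
    _ ≤ R.card + Finset.card {ε ∈ A | Φ ε ∈ R} := Finset.card_union_le _ _
    _ ≤ 2 * R.card := by omega

/-- Distinct signs are uncorrelated: flipping `ε a` negates the cross term, so variances add. -/
lemma sum_sq_signSum (B : Finset ι) :
    ∑ ε : ι → ℤˣ, signSum B ε ^ 2 = 2 ^ Fintype.card ι * B.card := by
  induction B using Finset.induction_on with
  | empty => simp [signSum]
  | insert a B ha ih =>
    have hcross : ∑ ε : ι → ℤˣ, ((ε a : ℤ) : ℝ) * signSum B ε = 0 := by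
      have hinv : Function.Involutive fun ε : ι → ℤˣ => Function.update ε a (-ε a) := by
        intro ε; simp
      have h := Equiv.sum_comp hinv.toPerm fun ε : ι → ℤˣ => ((ε a : ℤ) : ℝ) * signSum B ε
      have h2 : ∀ ε : ι → ℤˣ, signSum B (Function.update ε a (-ε a)) = signSum B ε := by
        intro ε
        refine Finset.sum_congr rfl fun i hi => ?_
        rw [Function.update_of_ne (ne_of_mem_of_not_mem hi ha)]
      simp only [Function.Involutive.coe_toPerm, h2, Function.update_self, Units.val_neg,
        Int.cast_neg, neg_mul, Finset.sum_neg_distrib] at h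
      linarith
    have hsq : ∀ ε : ι → ℤˣ, signSum (insert a B) ε ^ 2 =
        1 + 2 * (((ε a : ℤ) : ℝ) * signSum B ε) + signSum B ε ^ 2 := by
      intro ε
      have h1 : ((ε a : ℤ) : ℝ) ^ 2 = 1 := by
        rcases Int.units_eq_one_or (ε a) with h | h <;> simp [h]
      have h0 : signSum (insert a B) ε = ((ε a : ℤ) : ℝ) + signSum B ε :=
        Finset.sum_insert ha
      rw [h0, ← h1]; ring
    simp only [hsq, Finset.sum_add_distrib, ← Finset.mul_sum, hcross, ih,
      Finset.card_insert_of_notMem ha]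
    simp
    ring

open Classical in
lemma card_lt_abs_signSum_le (B : Finset ι) {l : ℝ} (hl : 0 < l) :
    (Finset.card {ε : ι → ℤˣ | l < |signSum B ε|} : ℝ) ≤
      2 ^ Fintype.card ι * (B.card / l ^ 2) := by
  rw [← mul_div_assoc, le_div_iff₀ (by positivity), ← sum_sq_signSum, ← nsmul_eq_mul]
  refine (Finset.card_nsmul_le_sum _ _ _ fun ε hε => ?_).trans
    (Finset.sum_le_sum_of_subset_of_nonneg (Finset.subset_univ _) fun _ _ _ => sq_nonneg _)
  rw [← sq_abs (signSum B ε)]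
  exact pow_le_pow_left₀ hl.le (Finset.mem_filter.1 hε).2.le 2

open Classical in
/-- Lévy's maximal inequality over a two-parameter family of index sets. -/
lemma card_exists_rectangle_le (D : Finset ι) (g y : ι → ℝ) {l : ℝ} (hl : 0 < l) :
    (Finset.card {ε : ι → ℤˣ | ∃ j, ∃ t : ℝ,
        l < |signSum {i ∈ D | y i ≤ t ∧ g i ≤ g j} ε|} : ℝ) ≤
      2 ^ Fintype.card ι * (4 * D.card / l ^ 2) := by
  -- Lévy is used twice, at a factor two each: along `g`, uniformly over the family of sets `{y ≤
  -- t}`, then along `y` for `D` alone.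
  have h1 := card_exists_sublevel_index_le g (range fun t : ℝ => D.filter (y · ≤ t)) l
  have h2 := card_exists_sublevel_index_le y {D} l
  have h3 := card_lt_abs_signSum_le D hl
  simp only [mem_range, exists_exists_eq_and, Finset.filter_filter] at h1
  simp only [mem_singleton_iff, exists_eq_left] at h2
  have h4 : Finset.card {ε : ι → ℤˣ | ∃ t : ℝ, l < |signSum (D.filter (y · ≤ t)) ε|} ≤
      Finset.card {ε : ι → ℤˣ | ∃ j, l < |signSum (D.filter (y · ≤ y j)) ε|} := by
    refine Finset.card_le_card fun ε hε => ?_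
    obtain ⟨t, ht⟩ := (Finset.mem_filter.1 hε).2
    have hne : (D.filter (y · ≤ t)).Nonempty := by
      by_contra h
      rw [Finset.not_nonempty_iff_eq_empty.1 h] at ht
      simp [signSum] at ht
      linarith
    obtain ⟨j, -, -, hj⟩ := exists_filter_le_eq y D t hne
    exact Finset.mem_filter.2 ⟨Finset.mem_univ _, j, hj ▸ ht⟩
  have h5 := h1.trans (Nat.mul_le_mul_left 2 (h4.trans h2))
  have h6 : (Finset.card {ε : ι → ℤˣ | ∃ j, ∃ t : ℝ,
        l < |signSum {i ∈ D | y i ≤ t ∧ g i ≤ g j} ε|} : ℝ) ≤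
      2 * (2 * Finset.card {ε : ι → ℤˣ | l < |signSum D ε|}) := by exact_mod_cast h5
  refine h6.trans ?_
  calc _ ≤ 2 * (2 * ((2:ℝ) ^ Fintype.card ι * (D.card / l ^ 2))) := by gcongr
    _ = _ := by ring

open Classical in
/-- A uniform bound for normalized two-parameter Rademacher sums, by peeling. -/
lemma card_exists_normalized_le (D : Finset ι) (g y : ι → ℝ) {m L : ℝ} (hm : 0 < m)
    (hL : 0 < L) :
    (Finset.card {ε : ι → ℤˣ | ∃ j, ∃ t : ℝ, m ≤ (D.filter (g · ≤ g j)).card ∧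
        L * (D.filter (g · ≤ g j)).card < |signSum {i ∈ D | y i ≤ t ∧ g i ≤ g j} ε|} : ℝ) ≤
      2 ^ Fintype.card ι * (16 / (L ^ 2 * m)) := by
  -- Peeling: blocks of size between `2 ^ k * m` and `2 ^ (k + 1) * m` are sublevel sets of `D' k`.
  -- There the variance grows like `2 ^ k` and the squared threshold like `4 ^ k`, leaving the ratio
  -- `1 / 2`.
  choose D' hD' hcard hD'eq using fun k : ℕ =>
    exists_filter_card_le D g (2 ^ (k + 1) * m) (by positivity)
  obtain ⟨J, hJ⟩ : ∃ J : ℕ, (D.card : ℝ) / m < 2 ^ J := pow_unbounded_of_one_lt _ one_lt_two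
  have hcover : ({ε : ι → ℤˣ | ∃ j, ∃ t : ℝ, m ≤ (D.filter (g · ≤ g j)).card ∧
        L * (D.filter (g · ≤ g j)).card < |signSum {i ∈ D | y i ≤ t ∧ g i ≤ g j} ε|} :
        Finset (ι → ℤˣ)) ⊆
      (Finset.range J).biUnion fun k => {ε : ι → ℤˣ | ∃ j, ∃ t : ℝ,
        L * (2 ^ k * m) < |signSum {i ∈ D' k | y i ≤ t ∧ g i ≤ g j} ε|} := by
    intro ε hε
    obtain ⟨j, t, hmj, hlt⟩ := (Finset.mem_filter.1 hε).2
    set N : ℝ := ((D.filter (g · ≤ g j)).card : ℝ) with hN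
    have hND : N ≤ D.card := Nat.cast_le.2 (Finset.card_filter_le _ _)
    obtain ⟨k, hk1, hk2⟩ := exists_nat_pow_near ((one_le_div hm).2 hmj) one_lt_two
    rw [le_div_iff₀ hm] at hk1
    rw [div_lt_iff₀ hm] at hk2
    have hkJ : k < J := by
      by_contra h
      have h1 : (2:ℝ) ^ J ≤ 2 ^ k := pow_le_pow_right₀ one_le_two (not_lt.1 h)
      rw [div_lt_iff₀ hm] at hJ
      nlinarith
    refine Finset.mem_biUnion.2 ⟨k, Finset.mem_range.2 hkJ, Finset.mem_filter.2
      ⟨Finset.mem_univ _, j, t, ?_⟩⟩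
    have heq : {i ∈ D' k | y i ≤ t ∧ g i ≤ g j} = {i ∈ D | y i ≤ t ∧ g i ≤ g j} := by
      have h := congrArg (Finset.filter (y · ≤ t)) (hD'eq k (g j) hk2.le)
      simp only [Finset.filter_filter] at h
      simp only [and_comm, h]
    rw [heq]
    exact (mul_le_mul_of_nonneg_left hk1 hL.le).trans_lt hlt
  calc _ ≤ ((∑ k ∈ Finset.range J, Finset.card {ε : ι → ℤˣ | ∃ j, ∃ t : ℝ,
        L * (2 ^ k * m) < |signSum {i ∈ D' k | y i ≤ t ∧ g i ≤ g j} ε|} : ℕ) : ℝ) := by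
        exact_mod_cast (Finset.card_le_card hcover).trans Finset.card_biUnion_le
    _ ≤ ∑ k ∈ Finset.range J, 2 ^ Fintype.card ι * (8 / (L ^ 2 * m)) * (1 / 2) ^ k := by
        push_cast
        refine Finset.sum_le_sum fun k _ => ?_
        refine (card_exists_rectangle_le (D' k) g y (by positivity)).trans ?_
        rw [mul_assoc]
        refine mul_le_mul_of_nonneg_left ?_ (by positivity)
        calc 4 * ((D' k).card : ℝ) / (L * (2 ^ k * m)) ^ 2
            ≤ 4 * (2 ^ (k + 1) * m) / (L * (2 ^ k * m)) ^ 2 := by gcongr; exact hcard k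
          _ = 8 / (L ^ 2 * m) * (1 / 2) ^ k := by
            rw [one_div, inv_pow]; field_simp; ring
    _ = 2 ^ Fintype.card ι * (8 / (L ^ 2 * m)) * ∑ k ∈ Finset.range J, (1 / 2 : ℝ) ^ k := by
        rw [Finset.mul_sum]
    _ ≤ 2 ^ Fintype.card ι * (8 / (L ^ 2 * m)) * 2 := by
        gcongr
        exact sum_geometric_two_le J
    _ = _ := by ring

end Rademacher

/-! ### Symmetrization and the uniform bound for centred indicators. -/

section Symmetrization

/-- Symmetrization by an independent copy for a countable family of random variables. -/
lemma measure_exists_lt_le_two_mul_prod {𝓨 κ : Type*} [MeasurableSpace 𝓨] [Countable κ]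
    (ν : Measure 𝓨) [IsProbabilityMeasure ν] (φ : κ → 𝓨 → ℝ) (l : κ → ℝ)
    (hφ : ∀ k, Measurable (φ k)) (hhalf : ∀ k, ν {y | l k / 2 < |φ k y|} ≤ 1 / 2) :
    ν {y | ∃ k, l k < |φ k y|} ≤
      2 * (ν.prod ν) {p | ∃ k, l k / 2 < |φ k p.1 - φ k p.2|} := by
  have hB : MeasurableSet {y | ∃ k, l k < |φ k y|} := by
    simp only [ofPred_exists]
    exact MeasurableSet.iUnion fun k => measurableSet_lt measurable_const (hφ k).abs
  have hE : MeasurableSet {p : 𝓨 × 𝓨 | ∃ k, l k / 2 < |φ k p.1 - φ k p.2|} := by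
    simp only [ofPred_exists]
    exact MeasurableSet.iUnion fun k => measurableSet_lt measurable_const
      (((hφ k).comp measurable_fst).sub ((hφ k).comp measurable_snd)).abs
  -- For a `y` exceeding at index `k`, the independent copy stays below `l k / 2` at the same `k`
  -- with probability at least one half; Fubini then compares the two events.
  have hsec : ∀ y ∈ {y | ∃ k, l k < |φ k y|}, (1 / 2 : ENNReal) ≤
      ν (Prod.mk y ⁻¹' {p : 𝓨 × 𝓨 | ∃ k, l k / 2 < |φ k p.1 - φ k p.2|}) := by
    rintro y ⟨k, hk⟩
    have hsub : {y' | l k / 2 < |φ k y'|}ᶜ ⊆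
        Prod.mk y ⁻¹' {p : 𝓨 × 𝓨 | ∃ k, l k / 2 < |φ k p.1 - φ k p.2|} := by
      intro y' hy'
      refine ⟨k, ?_⟩
      have h1 : |φ k y'| ≤ l k / 2 := not_lt.1 hy'
      have h2 := abs_sub_abs_le_abs_sub (φ k y) (φ k y')
      simp only
      linarith
    refine le_trans ?_ (measure_mono hsub)
    rw [prob_compl_eq_one_sub (measurableSet_lt measurable_const (hφ k).abs)]
    calc (1 / 2 : ENNReal) = 1 - 1 / 2 := by simp [ENNReal.one_sub_inv_two]
      _ ≤ _ := tsub_le_tsub_left (hhalf k) 1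
  rw [Measure.prod_apply hE]
  have h3 : (1 / 2 : ENNReal) * ν {y | ∃ k, l k < |φ k y|} ≤
      ∫⁻ y, ν (Prod.mk y ⁻¹' {p : 𝓨 × 𝓨 | ∃ k, l k / 2 < |φ k p.1 - φ k p.2|}) ∂ν := by
    rw [← setLIntegral_const]
    exact (setLIntegral_mono' hB hsec).trans (setLIntegral_le_lintegral _ _)
  calc ν {y | ∃ k, l k < |φ k y|}
      = 2 * ((1 / 2 : ENNReal) * ν {y | ∃ k, l k < |φ k y|}) := by
        rw [← mul_assoc, one_div, ENNReal.mul_inv_cancel two_ne_zero ENNReal.ofNat_ne_top,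
          one_mul]
    _ ≤ _ := by gcongr

variable {ι : Type*}

/-- The centred empirical distribution function at `t`, summed over `i ∈ B`. -/
noncomputable def centredSum (p : ι → ℝ → ℝ) (B : Finset ι) (y : ι → ℝ) (t : ℝ) : ℝ :=
  ∑ i ∈ B, ((Iic t).indicator (fun _ => (1 : ℝ)) (y i) - p i t)

lemma measurable_centredSum (p : ι → ℝ → ℝ) (B : Finset ι) (t : ℝ) :
    Measurable fun y => centredSum p B y t := by
  unfold centredSum
  refine Finset.measurable_sum _ fun i _ => Measurable.sub_const ?_ _
  exact (measurable_const.indicator measurableSet_Iic).comp (measurable_pi_apply i)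

/-- Sums over sublevel sets of `g` of the sign-weighted symmetrized indicators. -/
noncomputable def symmSum (B : Finset ι) (t : ℝ) (ε : ι → ℤˣ) (w : ι → ℝ × ℝ) : ℝ :=
  ∑ i ∈ B, ((ε i : ℤ) : ℝ) * ((Iic t).indicator (fun _ => (1 : ℝ)) (w i).1 -
    (Iic t).indicator (fun _ => (1 : ℝ)) (w i).2)

lemma measurable_symmSum (B : Finset ι) (t : ℝ) (ε : ι → ℤˣ) :
    Measurable (symmSum B t ε) := by
  unfold symmSum
  have h : Measurable ((Iic t).indicator fun _ => (1 : ℝ)) :=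
    measurable_const.indicator measurableSet_Iic
  exact Finset.measurable_sum _ fun i _ => measurable_const.mul
    ((h.comp (measurable_fst.comp (measurable_pi_apply i))).sub
      (h.comp (measurable_snd.comp (measurable_pi_apply i))))

lemma symmSum_eq (D : Finset ι) (p : ι → Prop) [DecidablePred p] (t : ℝ) (ε : ι → ℤˣ)
    (w : ι → ℝ × ℝ) :
    symmSum {i ∈ D | p i} t ε w = signSum {i ∈ D | (w i).1 ≤ t ∧ p i} ε -
      signSum {i ∈ D | (w i).2 ≤ t ∧ p i} ε := by
  classical
  unfold symmSum signSum
  simp only [Finset.sum_filter]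
  rw [← Finset.sum_sub_distrib]
  refine Finset.sum_congr rfl fun i _ => ?_
  by_cases h : p i <;> by_cases h1 : (w i).1 ≤ t <;> by_cases h2 : (w i).2 ≤ t <;>
    simp [h, h1, h2]

variable [Fintype ι]

lemma pi_lt_abs_centredSum_le (μ : ι → Measure ℝ) [∀ i, IsProbabilityMeasure (μ i)]
    (B : Finset ι) (t : ℝ) {l : ℝ} (hl : 0 < l) :
    Measure.pi μ {y | l < |centredSum (fun i t => (μ i).real (Iic t)) B y t|} ≤
      ENNReal.ofReal (B.card / l ^ 2) := by
  classical
  set f : ℝ → ℝ := (Iic t).indicator fun _ => (1 : ℝ) with hf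
  have hfm : Measurable f := measurable_const.indicator measurableSet_Iic
  have hfb : ∀ z, f z ∈ Icc (0:ℝ) 1 := by
    intro z
    by_cases hz : z ∈ Iic t <;> simp [hf, hz]
  set X : ι → (ι → ℝ) → ℝ := fun i y => f (y i) with hX
  have hXm : ∀ i, Measurable (X i) := fun i => hfm.comp (measurable_pi_apply i)
  have hL : ∀ i, MemLp (X i) 2 (Measure.pi μ) := fun i =>
    MemLp.of_bound (hXm i).aestronglyMeasurable 1 (ae_of_all _ fun y => by
      rw [Real.norm_eq_abs, abs_of_nonneg (hfb _).1]; exact (hfb _).2)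
  have hmean : ∀ i, ∫ y, X i y ∂Measure.pi μ = (μ i).real (Iic t) := by
    intro i
    have h := integral_map (μ := Measure.pi μ) (measurable_pi_apply i).aemeasurable
      (f := f) hfm.aestronglyMeasurable
    rw [(measurePreserving_eval μ i).map_eq] at h
    rw [show ∫ y, X i y ∂Measure.pi μ = _ from h.symm]
    exact integral_indicator_one measurableSet_Iic
  have hvar : variance (∑ i ∈ B, X i) (Measure.pi μ) ≤ B.card := by
    rw [IndepFun.variance_sum (fun i _ => hL i) fun i _ j _ hij =>
      (iIndepFun_pi (X := fun _ => f) fun i => hfm.aemeasurable).indepFun hij]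
    calc _ ≤ ∑ i ∈ B, (1:ℝ) := Finset.sum_le_sum fun i _ => by
          have h := variance_le_sq_of_bounded (a := 0) (b := 1) (X := X i)
            (μ := Measure.pi μ) (ae_of_all _ fun y => hfb _) (hXm i).aemeasurable
          norm_num at h ⊢
          linarith
      _ = _ := by simp
  have hS : MemLp (∑ i ∈ B, X i) 2 (Measure.pi μ) := memLp_finsetSum' _ fun i _ => hL i
  have hcheb := meas_ge_le_variance_div_sq hS hl
  refine (measure_mono ?_).trans (hcheb.trans (ENNReal.ofReal_le_ofReal (by gcongr)))
  intro y hy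
  have hint : ∫ y, (∑ i ∈ B, X i) y ∂Measure.pi μ = ∑ i ∈ B, (μ i).real (Iic t) := by
    simp only [Finset.sum_apply]
    rw [integral_finsetSum _ fun i _ => (hL i).integrable one_le_two]
    exact Finset.sum_congr rfl fun i _ => hmean i
  rw [mem_ofPred_eq, hint, Finset.sum_apply, ← Finset.sum_sub_distrib]
  exact le_of_lt hy

/-- The random signs do not change the law of the symmetrized sums. -/
lemma pi_symm_eq (μ : ι → Measure ℝ) [∀ i, IsProbabilityMeasure (μ i)] {κ : Type*}
    [Countable κ] (B : κ → Finset ι) (t l : κ → ℝ) (ε : ι → ℤˣ) :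
    Measure.pi (fun i => (μ i).prod (μ i)) {w | ∃ k, l k < |symmSum (B k) (t k) ε w|} =
      Measure.pi (fun i => (μ i).prod (μ i)) {w | ∃ k, l k < |symmSum (B k) (t k) 1 w|} := by
  -- A negative sign amounts to exchanging an observation with its copy, which preserves the product
  -- law.
  set f : ι → ℝ × ℝ → ℝ × ℝ := fun i => if ε i = 1 then id else Prod.swap with hf
  have hfm : ∀ i, MeasurePreserving (f i) ((μ i).prod (μ i)) ((μ i).prod (μ i)) := by
    intro i
    simp only [hf]
    split_ifs
    · exact MeasurePreserving.id _
    · exact Measure.measurePreserving_swap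
  have hmeas : MeasurableSet {w | ∃ k, l k < |symmSum (B k) (t k) 1 w|} := by
    simp only [ofPred_exists]
    exact MeasurableSet.iUnion fun k => measurableSet_lt measurable_const
      (measurable_symmSum _ _ _).abs
  rw [← (measurePreserving_pi _ _ hfm).measure_preimage hmeas.nullMeasurableSet]
  congr 1
  have : ∀ k w, symmSum (B k) (t k) 1 (fun i => f i (w i)) = symmSum (B k) (t k) ε w := by
    intro k w
    refine Finset.sum_congr rfl fun i _ => ?_
    rcases Int.units_eq_one_or (ε i) with h | h
    · simp [hf, h]
    · simp [hf, h]
  ext w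
  simp only [mem_preimage, mem_ofPred_eq, this]

variable [DecidableEq ι]

open Classical in
/-- A uniform bound for the normalized symmetrized sums. -/
lemma pi_exists_symmSum_le (μ : ι → Measure ℝ) [∀ i, IsProbabilityMeasure (μ i)]
    (D : Finset ι) (g : ι → ℝ) {m L : ℝ} (hm : 0 < m) (hL : 0 < L) {κ : Type*} [Countable κ]
    (J : κ → ι) (t : κ → ℝ) (hJ : ∀ k, m ≤ (D.filter (g · ≤ g (J k))).card) :
    Measure.pi (fun i => (μ i).prod (μ i)) {w | ∃ k,
      2 * (L * (D.filter (g · ≤ g (J k))).card) < |symmSum (D.filter (g · ≤ g (J k))) (t k) 1 w|}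
      ≤ ENNReal.ofReal (32 / (L ^ 2 * m)) := by
  set π := Measure.pi fun i => (μ i).prod (μ i)
  set E : (ι → ℤˣ) → Set (ι → ℝ × ℝ) := fun ε => {w | ∃ k,
    2 * (L * (D.filter (g · ≤ g (J k))).card) <
      |symmSum (D.filter (g · ≤ g (J k))) (t k) ε w|} with hE
  have hEm : ∀ ε, MeasurableSet (E ε) := by
    intro ε
    simp only [hE, ofPred_exists]
    exact MeasurableSet.iUnion fun k => measurableSet_lt measurable_const
      (measurable_symmSum _ _ _).abs
  have hEeq : ∀ ε, π (E ε) = π (E 1) := fun ε => pi_symm_eq μ _ t _ ε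
  -- Averaging over all signs and exchanging sum and integral leaves, for each fixed `w`, a count of
  -- sign vectors. The two samples contribute `16 / (L ^ 2 * m)` each.
  have hsum : ∑ ε : ι → ℤˣ, π (E ε) = 2 ^ Fintype.card ι * π (E 1) := by
    simp [hEeq]
  have hcount : ∀ w, ∑ ε : ι → ℤˣ, (E ε).indicator (1 : (ι → ℝ × ℝ) → ENNReal) w ≤
      ENNReal.ofReal (2 ^ Fintype.card ι * (32 / (L ^ 2 * m))) := by
    intro w
    have h1 : ∑ ε : ι → ℤˣ, (E ε).indicator (1 : (ι → ℝ × ℝ) → ENNReal) w =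
        ENNReal.ofReal (Finset.card {ε : ι → ℤˣ | w ∈ E ε}) := by
      rw [ENNReal.ofReal_natCast, Finset.card_filter]
      push_cast
      exact Finset.sum_congr rfl fun ε _ => by simp [indicator_apply]
    rw [h1]
    refine ENNReal.ofReal_le_ofReal ?_
    have hsub : ({ε : ι → ℤˣ | w ∈ E ε} : Finset _) ⊆
        ({ε : ι → ℤˣ | ∃ j, ∃ t : ℝ, m ≤ (D.filter (g · ≤ g j)).card ∧
          L * (D.filter (g · ≤ g j)).card <
            |signSum {i ∈ D | (w i).1 ≤ t ∧ g i ≤ g j} ε|} : Finset _) ∪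
        ({ε : ι → ℤˣ | ∃ j, ∃ t : ℝ, m ≤ (D.filter (g · ≤ g j)).card ∧
          L * (D.filter (g · ≤ g j)).card <
            |signSum {i ∈ D | (w i).2 ≤ t ∧ g i ≤ g j} ε|} : Finset _) := by
      intro ε hε
      obtain ⟨k, hk⟩ := (Finset.mem_filter.1 hε).2
      rw [symmSum_eq] at hk
      have h2 := abs_sub (signSum {i ∈ D | (w i).1 ≤ t k ∧ g i ≤ g (J k)} ε)
        (signSum {i ∈ D | (w i).2 ≤ t k ∧ g i ≤ g (J k)} ε)
      by_cases h3 : L * (D.filter (g · ≤ g (J k))).card <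
          |signSum {i ∈ D | (w i).1 ≤ t k ∧ g i ≤ g (J k)} ε|
      · exact Finset.mem_union_left _ (Finset.mem_filter.2
          ⟨Finset.mem_univ _, J k, t k, hJ k, h3⟩)
      · exact Finset.mem_union_right _ (Finset.mem_filter.2
          ⟨Finset.mem_univ _, J k, t k, hJ k, by linarith⟩)
    have h4 := (Finset.card_le_card hsub).trans (Finset.card_union_le _ _)
    have h5 := card_exists_normalized_le D g (fun i => (w i).1) hm hL
    have h6 := card_exists_normalized_le D g (fun i => (w i).2) hm hL
    have h7 : (Finset.card {ε : ι → ℤˣ | w ∈ E ε} : ℝ) ≤ _ := Nat.cast_le.2 h4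
    rw [Nat.cast_add] at h7
    calc _ ≤ _ := h7
      _ ≤ _ := add_le_add h5 h6
      _ = _ := by ring
  have htot : 2 ^ Fintype.card ι * π (E 1) ≤
      2 ^ Fintype.card ι * ENNReal.ofReal (32 / (L ^ 2 * m)) := by
    rw [← hsum]
    calc ∑ ε : ι → ℤˣ, π (E ε) = ∫⁻ w, ∑ ε : ι → ℤˣ, (E ε).indicator (1 : (ι → ℝ × ℝ) → ENNReal) w ∂π := by
          rw [lintegral_finsetSum _ fun ε _ => measurable_one.indicator (hEm ε)]
          exact Finset.sum_congr rfl fun ε _ => (lintegral_indicator_one (hEm ε)).symm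
      _ ≤ ∫⁻ _, ENNReal.ofReal (2 ^ Fintype.card ι * (32 / (L ^ 2 * m))) ∂π :=
          lintegral_mono hcount
      _ = _ := by
          rw [lintegral_const, measure_univ, mul_one, ENNReal.ofReal_mul (by positivity),
            ENNReal.ofReal_pow (by norm_num), ENNReal.ofReal_ofNat]
  exact (ENNReal.mul_le_mul_iff_right (by simp) (by simp)).1 htot

/-- A maximal inequality for sums of independent centred indicators `1[y i ≤ t]`, uniformly in
`t` and in the sublevel sets of `g` having at least `m` elements. -/
theorem pi_exists_centredSum_le (μ : ι → Measure ℝ) [∀ i, IsProbabilityMeasure (μ i)]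
    (D : Finset ι) (g : ι → ℝ) {m L : ℝ} (hm : 0 < m) (hL : 0 < L) (hLm : 8 ≤ L ^ 2 * m) :
    Measure.pi μ {y | ∃ j, ∃ q : ℚ, m ≤ (D.filter (g · ≤ g j)).card ∧
      L * (D.filter (g · ≤ g j)).card <
        |centredSum (fun i t => (μ i).real (Iic t)) (D.filter (g · ≤ g j)) y q|} ≤
      ENNReal.ofReal (1024 / (L ^ 2 * m)) := by
  set κ := {j : ι // m ≤ (D.filter (g · ≤ g j)).card} × ℚ
  set B : κ → Finset ι := fun k => D.filter (g · ≤ g k.1) with hB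
  set φ : κ → (ι → ℝ) → ℝ := fun k y =>
    centredSum (fun i t => (μ i).real (Iic t)) (B k) y k.2 with hφ
  have hset : {y | ∃ j, ∃ q : ℚ, m ≤ (D.filter (g · ≤ g j)).card ∧
      L * (D.filter (g · ≤ g j)).card <
        |centredSum (fun i t => (μ i).real (Iic t)) (D.filter (g · ≤ g j)) y q|} =
      {y | ∃ k : κ, L * (B k).card < |φ k y|} := by
    ext y
    constructor
    · rintro ⟨j, q, h1, h2⟩
      exact ⟨⟨⟨j, h1⟩, q⟩, h2⟩
    · rintro ⟨⟨⟨j, h1⟩, q⟩, h2⟩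
      exact ⟨j, q, h1, h2⟩
  have hBm : ∀ k, m ≤ (B k).card := fun k => k.1.2
  rw [hset]
  refine (measure_exists_lt_le_two_mul_prod (Measure.pi μ) φ (fun k => L * (B k).card)
    (fun k => measurable_centredSum _ _ _) fun k => ?_).trans ?_
  -- Chebyshev at level `L N / 2` gives `4 / (L ^ 2 * N)`, where `N` is the block size; `hLm` makes
  -- this at most one half.
  · have hpos : 0 < ((B k).card : ℝ) := hm.trans_le (hBm k)
    refine (pi_lt_abs_centredSum_le μ (B k) k.2 (by positivity)).trans ?_
    rw [show (1 / 2 : ENNReal) = ENNReal.ofReal (1 / 2) by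
      rw [ENNReal.ofReal_div_of_pos two_pos]; simp]
    refine ENNReal.ofReal_le_ofReal ?_
    rw [div_le_div_iff₀ (by positivity) two_pos]
    have h1 : L ^ 2 * m ≤ L ^ 2 * (B k).card :=
      mul_le_mul_of_nonneg_left (hBm k) (sq_nonneg L)
    nlinarith
  · have hmp := measurePreserving_arrowProdEquivProdArrow ℝ ℝ ι μ μ
    rw [← hmp.measure_preimage_equiv]
    -- Symmetrization halves the threshold and the split into two samples halves it again, hence `L
    -- / 4` and `1024 = 2 * 32 * 16`.
    have h := pi_exists_symmSum_le μ D g hm (L := L / 4) (by positivity)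
      (fun k : κ => k.1.1) (fun k => (k.2 : ℝ)) hBm
    calc _ ≤ 2 * ENNReal.ofReal (32 / ((L / 4) ^ 2 * m)) := by
          gcongr
          refine le_trans (measure_mono ?_) h
          rintro w ⟨k, hk⟩
          refine ⟨k, ?_⟩
          have h1 : φ k (fun i => (w i).1) - φ k (fun i => (w i).2) =
              symmSum (B k) k.2 1 w := by
            simp only [hφ, centredSum, symmSum]
            rw [← Finset.sum_sub_distrib]
            exact Finset.sum_congr rfl fun i _ => by simp
          rw [← h1]
          refine lt_of_le_of_lt (le_of_eq ?_) hk
          ring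
      _ = _ := by
          rw [← ENNReal.ofReal_ofNat 2, ← ENNReal.ofReal_mul (by norm_num)]
          congr 1
          field_simp
          norm_num

end Symmetrization

/-! ### Antitonic least squares and the one-sided bounds near `x₀`. -/

section LeastSquares

variable {n : ℕ} {x z y : Fin n → ℝ}

/-- The indices of the design points between `b` and `x j`, in the order reversed by `σ = -1`. -/
noncomputable def block (σ b : ℝ) (x : Fin n → ℝ) (j : Fin n) : Finset (Fin n) :=
  {i | b ≤ σ * x i ∧ σ * x i ≤ σ * x j}

lemma IsAntitonicLS.neg {f : ℝ → ℝ} (h : IsAntitonicLS x z f) :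
    IsAntitonicLS (fun i => -x i) (fun i => -z i) (fun u => -f (-u)) where
  anti := by
    rintro _ ⟨i, rfl⟩ _ ⟨j, rfl⟩ hij
    simp only [neg_neg, neg_le_neg_iff] at hij ⊢
    exact h.anti ⟨j, rfl⟩ ⟨i, rfl⟩ hij
  minimal := by
    intro k hk
    have h1 := h.minimal (fun u => -k (-u)) (by
      rintro _ ⟨i, rfl⟩ _ ⟨j, rfl⟩ hij
      exact neg_le_neg (hk ⟨j, rfl⟩ ⟨i, rfl⟩ (neg_le_neg hij)))
    calc ∑ i, (-z i - -f (- -x i)) ^ 2 = ∑ i, (z i - f (x i)) ^ 2 :=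
          Finset.sum_congr rfl fun i _ => by rw [neg_neg]; ring
      _ ≤ _ := h1
      _ = _ := Finset.sum_congr rfl fun i _ => by ring

/-- Constant data are fitted exactly. This makes the estimator `0` below and `1` above all
responses, so its quantile infima are genuine rather than the default value of `sInf`. -/
lemma IsAntitonicLS.eq_of_const {f : ℝ → ℝ} {c : ℝ} (h : IsAntitonicLS x z f)
    (hz : ∀ i, z i = c) (i : Fin n) : f (x i) = c := by
  have h1 := h.minimal (fun _ => c) (antitoneOn_const)
  simp only [hz, sub_self, ne_eq, OfNat.ofNat_ne_zero, not_false_eq_true, zero_pow,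
    Finset.sum_const_zero] at h1
  have h2 := (Finset.sum_eq_zero_iff_of_nonneg fun i _ => sq_nonneg (c - f (x i))).1
    (le_antisymm h1 (Finset.sum_nonneg fun i _ => sq_nonneg _)) i (Finset.mem_univ i)
  have h3 := pow_eq_zero_iff two_ne_zero |>.1 h2
  linarith

/-- Take `x j` leftmost on the level set of `f` through `x k`. Since `f` drops strictly just before
`x j`, raising it slightly on the block from `x j` to `-b` keeps it antitonic; minimality makes the
residual sum there nonpositive. Replacing `f (x i)` by the larger `f (x k)` only decreases the sum.
-/
lemma IsAntitonicLS.exists_block_neg {f : ℝ → ℝ} (h : IsAntitonicLS x z f) (b : ℝ) (k : Fin n) :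
    ∃ j, x j ≤ x k ∧ ∑ i ∈ block (-1) b x j, (z i - f (x k)) ≤ 0 := by
  classical
  obtain ⟨j, hj, hmin⟩ := Finset.exists_min_image
    (Finset.univ.filter fun i => f (x i) = f (x k)) x ⟨k, by simp⟩
  have hjk : f (x j) = f (x k) := (Finset.mem_filter.1 hj).2
  refine ⟨j, hmin k (by simp), ?_⟩
  set B := block (-1) b x j with hB
  have hmemB : ∀ i, i ∈ B ↔ (b ≤ -1 * x i ∧ -1 * x i ≤ -1 * x j) := fun i => by
    simp [hB, block]
  obtain ⟨η₀, hη₀, hgap⟩ : ∃ η₀ > 0, ∀ i, x i < x j → f (x j) + η₀ ≤ f (x i) := by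
    have hpos : ∀ i, x i < x j → 0 < f (x i) - f (x j) := by
      intro i hi
      have h1 : f (x j) ≤ f (x i) := h.anti ⟨i, rfl⟩ ⟨j, rfl⟩ hi.le
      have h2 : f (x i) ≠ f (x j) := fun he =>
        absurd (hmin i (by simp [he, hjk])) (not_le.2 hi)
      exact sub_pos.2 (lt_of_le_of_ne h1 h2.symm)
    rcases (Finset.univ.filter fun i => x i < x j).eq_empty_or_nonempty with he | hne
    · exact ⟨1, one_pos, fun i hi => absurd (Finset.mem_filter.2 ⟨Finset.mem_univ i, hi⟩)
        (by rw [he]; simp)⟩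
    · obtain ⟨i₀, hi₀, hm⟩ := Finset.exists_min_image _ (fun i => f (x i) - f (x j)) hne
      refine ⟨_, hpos i₀ (Finset.mem_filter.1 hi₀).2, fun i hi => ?_⟩
      have := hm i (Finset.mem_filter.2 ⟨Finset.mem_univ i, hi⟩)
      linarith
  have hpert : ∀ η, 0 ≤ η → η ≤ η₀ → 2 * η * ∑ i ∈ B, (z i - f (x i)) ≤ η ^ 2 * B.card := by
    intro η h0 h1
    have hanti : AntitoneOn
        (fun u => f u + if b ≤ -1 * u ∧ -1 * u ≤ -1 * x j then η else 0) (range x) := by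
      rintro _ ⟨i, rfl⟩ _ ⟨i', rfl⟩ hii
      have hf : f (x i') ≤ f (x i) := h.anti ⟨i, rfl⟩ ⟨i', rfl⟩ hii
      simp only
      split_ifs with ha hb hb
      · linarith
      · have hlt : x i < x j := by
          by_contra hc
          exact hb ⟨by linarith [ha.1], by linarith⟩
        have := hgap i hlt
        have h3 : f (x i') ≤ f (x j) := h.anti ⟨j, rfl⟩ ⟨i', rfl⟩ (by linarith [ha.2])
        linarith
      · linarith
      · linarith
    have hm := h.minimal _ hanti
    have hexp : ∀ i, (z i - (f (x i) + if b ≤ -1 * x i ∧ -1 * x i ≤ -1 * x j then η else 0)) ^ 2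
        = (z i - f (x i)) ^ 2 + (if i ∈ B then η ^ 2 - 2 * η * (z i - f (x i)) else 0) := by
      intro i
      simp only [hmemB]
      split_ifs <;> ring
    simp only [hexp, Finset.sum_add_distrib] at hm
    rw [Finset.sum_ite_mem, Finset.univ_inter, Finset.sum_sub_distrib, ← Finset.mul_sum,
      Finset.sum_const, nsmul_eq_mul] at hm
    linarith
  have hS : ∑ i ∈ B, (z i - f (x i)) ≤ 0 := by
    by_contra hc
    set s := ∑ i ∈ B, (z i - f (x i))
    have hs : 0 < s := not_le.1 hc
    set N : ℝ := (B.card : ℝ)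
    have hN : 0 ≤ N := Nat.cast_nonneg _
    -- Small enough that the linear gain `2 * η * s` beats the quadratic cost `η ^ 2 * N`.
    set η := min η₀ (s / (N + 1))
    have hη : 0 < η := lt_min hη₀ (by positivity)
    have h1 := hpert η hη.le (min_le_left _ _)
    have h2 : η * (N + 1) ≤ s := (le_div_iff₀ (by positivity)).1 (min_le_right _ _)
    nlinarith
  refine le_trans (Finset.sum_le_sum fun i hi => ?_) hS
  have := h.anti ⟨j, rfl⟩ ⟨i, rfl⟩ (by linarith [((hmemB i).1 hi).2] : x j ≤ x i)
  linarith

/-- One inequality of the min-max characterization of antitonic least squares. -/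
lemma IsAntitonicLS.exists_block {f : ℝ → ℝ} (h : IsAntitonicLS x z f) {σ : ℝ}
    (hσ : σ = 1 ∨ σ = -1) (b : ℝ) (k : Fin n) :
    ∃ j, σ * x k ≤ σ * x j ∧ 0 ≤ σ * ∑ i ∈ block σ b x j, (z i - f (x k)) := by
  rcases hσ with rfl | rfl
  · obtain ⟨j, h1, h2⟩ := h.neg.exists_block_neg b k
    refine ⟨j, by linarith, ?_⟩
    have hB : block (-1) b (fun i => -x i) j = block 1 b x j := by
      simp [block]
    rw [hB] at h2
    have h3 : ∑ i ∈ block 1 b x j, (-z i - -f (- -x k)) =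
        -∑ i ∈ block 1 b x j, (z i - f (x k)) := by
      rw [← Finset.sum_neg_distrib]
      exact Finset.sum_congr rfl fun i _ => by rw [neg_neg]; ring
    linarith
  · obtain ⟨j, h1, h2⟩ := h.exists_block_neg b k
    exact ⟨j, by linarith, by linarith⟩

/-- Right-continuity in `t` lets the noise event be a countable union over rational levels while
still controlling every real one. -/
lemma centredSum_le_of_rat {ι : Type*} (p : ι → ℝ → ℝ)
    (hp : ∀ i t, ContinuousWithinAt (p i) (Ici t) t) (B : Finset ι) (y : ι → ℝ) {c : ℝ}
    (h : ∀ q : ℚ, |centredSum p B y q| ≤ c) (t : ℝ) : |centredSum p B y t| ≤ c := by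
  by_contra hc
  have hind : ∀ i, ContinuousWithinAt
      (fun t => (Iic t).indicator (fun _ => (1 : ℝ)) (y i)) (Ici t) t := by
    intro i
    rcases le_or_gt (y i) t with hy | hy
    · refine (continuousWithinAt_const (b := (1 : ℝ))).congr (fun s hs => ?_) ?_
      · exact indicator_of_mem (show y i ∈ Iic s from hy.trans hs) _
      · exact indicator_of_mem (show y i ∈ Iic t from hy) _
    · refine ((continuousAt_const (y := (0 : ℝ))).congr ?_).continuousWithinAt
      filter_upwards [Iio_mem_nhds hy] with s hs
      exact (indicator_of_notMem (fun h => absurd (mem_Iio.1 hs) (not_lt.2 (mem_Iic.1 h))) _).symm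
  have hcont : ContinuousWithinAt (fun t => |centredSum p B y t|) (Ici t) t := by
    unfold centredSum
    exact (tendsto_finsetSum _ fun i _ => (hind i).sub (hp i t)).abs
  have hev := hcont.eventually (lt_mem_nhds (not_le.1 hc))
  obtain ⟨u, hu, hsub⟩ := mem_nhdsGE_iff_exists_Ico_subset.1 hev
  obtain ⟨q, hq1, hq2⟩ := exists_rat_btwn (mem_Ioi.1 hu)
  exact absurd (h q) (not_le.2 (hsub ⟨hq1.le, hq2⟩))

/-- If the centred sums over large blocks are small, the estimator at a design point on one
side of `x₀` is bounded by the true distribution function at the end of the block. -/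
lemma IsDistributionEstimator.exists_bound {S : Set ℝ} {F G : ℝ → ℝ → ℝ}
    (hF : IsStochasticallyOrdered S F) (hG : IsDistributionEstimator x y G) (hx : ∀ i, x i ∈ S)
    {σ b x₀ m L : ℝ} (hσ : σ = 1 ∨ σ = -1) (hb : σ * b ∈ S) (hm : 0 < m)
    (hcount : m ≤ Finset.card {i | b ≤ σ * x i ∧ σ * x i ≤ σ * x₀})
    (hnoise : ∀ j, m ≤ (block σ b x j).card → ∀ t,
      |centredSum (fun i => F (x i)) (block σ b x j) y t| ≤ L * (block σ b x j).card) :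
    ∃ k, σ * x k ≤ σ * x₀ ∧ ∀ t, σ * G (x k) t ≤ σ * F (σ * b) t + L := by
  have hne : (Finset.univ.filter fun i => b ≤ σ * x i ∧ σ * x i ≤ σ * x₀).Nonempty := by
    rw [← Finset.card_pos]
    exact_mod_cast hm.trans_le hcount
  obtain ⟨k, hk, hmax⟩ := Finset.exists_max_image _ (fun i => σ * x i) hne
  refine ⟨k, (Finset.mem_filter.1 hk).2.2, fun t => ?_⟩
  -- Here `j` varies with `t` while `k` does not. As `x k` is the design point of the window nearest
  -- `x₀`, the block contains the whole window and so has at least `m` points.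
  obtain ⟨j, hkj, hsum⟩ := (hG t).exists_block hσ b k
  set B := block σ b x j with hB
  have hmB : m ≤ B.card := by
    refine hcount.trans (Nat.cast_le.2 (Finset.card_le_card fun i hi => ?_))
    exact Finset.mem_filter.2 ⟨Finset.mem_univ i, (Finset.mem_filter.1 hi).2.1,
      (hmax i hi).trans hkj⟩
  have hpos : 0 < (B.card : ℝ) := hm.trans_le hmB
  have hn := hnoise j hmB t
  have hFle : ∀ i ∈ B, σ * F (x i) t ≤ σ * F (σ * b) t := by
    intro i hi
    have hi1 : b ≤ σ * x i := (Finset.mem_filter.1 hi).2.1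
    rcases hσ with rfl | rfl
    · have := hF.anti t hb (hx i) (by linarith)
      simp only at this
      linarith
    · have := hF.anti t (hx i) hb (by linarith)
      simp only at this
      linarith
  have hsplit : σ * ∑ i ∈ B, ((Iic t).indicator (fun _ => (1 : ℝ)) (y i) - G (x k) t) =
      σ * centredSum (fun i => F (x i)) B y t + ∑ i ∈ B, σ * F (x i) t -
        B.card * (σ * G (x k) t) := by
    unfold centredSum
    rw [Finset.sum_sub_distrib, Finset.sum_sub_distrib, Finset.sum_const, nsmul_eq_mul,
      ← Finset.mul_sum]
    ring
  have hσn : σ * centredSum (fun i => F (x i)) B y t ≤ L * B.card := by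
    refine le_trans (le_abs_self _) ?_
    rw [abs_mul]
    rcases hσ with rfl | rfl <;> simpa using hn
  have hsF : ∑ i ∈ B, σ * F (x i) t ≤ B.card * (σ * F (σ * b) t) := by
    rw [← nsmul_eq_mul]
    exact Finset.sum_le_card_nsmul _ _ _ hFle
  have hfin : (B.card : ℝ) * (σ * G (x k) t) ≤ B.card * (σ * F (σ * b) t + L) := by
    rw [hsplit] at hsum
    linarith
  exact le_of_mul_le_mul_left hfin hpos

lemma IsDistributionEstimator.bddBelow {G : ℝ → ℝ → ℝ} (hG : IsDistributionEstimator x y G)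
    (k : Fin n) {β : ℝ} (hβ : 0 < β) : BddBelow {t | β < G (x k) t} := by
  obtain ⟨a, ha⟩ := (finite_range y).bddBelow
  refine ⟨a, fun t ht => ?_⟩
  by_contra hc
  have h0 := (hG t).eq_of_const (c := 0) (fun i => indicator_of_notMem (s := Iic t)
    (fun h => absurd (ha ⟨i, rfl⟩) (not_le.2 (lt_of_le_of_lt h (not_le.1 hc)))) _) k
  have : β < G (x k) t := ht
  linarith

lemma IsDistributionEstimator.nonempty {G : ℝ → ℝ → ℝ} (hG : IsDistributionEstimator x y G)
    (k : Fin n) {β : ℝ} (hβ : β ≤ 1) : {t | β ≤ G (x k) t}.Nonempty := by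
  obtain ⟨a, ha⟩ := (finite_range y).bddAbove
  refine ⟨a, ?_⟩
  have h1 := (hG a).eq_of_const (c := 1) (fun i => indicator_of_mem
    (show y i ∈ Iic a from ha ⟨i, rfl⟩) _) k
  exact hβ.trans_eq h1.symm

end LeastSquares

/-! ### From distribution functions to quantiles. -/

section Quantiles

lemma le_of_lt_of_le_maxQuantile {G : ℝ → ℝ} {β r t : ℝ} (hG : BddBelow {t | β < G t})
    (hr : r ≤ maxQuantile G β) (ht : t < r) : G t ≤ β := by
  by_contra hc
  exact absurd (csInf_le hG (not_le.1 hc)) (not_le.2 (ht.trans_le hr))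

lemma exists_lt_of_minQuantile_le {G : ℝ → ℝ} {β r t : ℝ} (hG : {t | β ≤ G t}.Nonempty)
    (hr : minQuantile G β ≤ r) (ht : r < t) : ∃ s < t, β ≤ G s := by
  obtain ⟨s, hs, hst⟩ := exists_lt_of_csInf_lt hG (lt_of_le_of_lt hr ht)
  exact ⟨s, hst, hs⟩

lemma IsDistributionFunction.bddBelow {G : ℝ → ℝ} (hG : IsDistributionFunction G) {β : ℝ}
    (hβ : 0 < β) : BddBelow {t | β < G t} := by
  obtain ⟨a, ha⟩ := (hG.atBot.eventually (gt_mem_nhds hβ)).exists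
  refine ⟨a, fun t ht => ?_⟩
  by_contra hc
  exact absurd (lt_of_lt_of_le ht (hG.mono (not_le.1 hc).le)) (not_lt.2 ha.le)

lemma IsDistributionFunction.nonempty {G : ℝ → ℝ} (hG : IsDistributionFunction G) {β : ℝ}
    (hβ : β < 1) : {t | β ≤ G t}.Nonempty := by
  obtain ⟨a, ha⟩ := (hG.atTop.eventually (lt_mem_nhds hβ)).exists
  exact ⟨a, ha.le⟩

/-- Between `r` and `s` the values of `G` are confined to `[lo, hi]`, while `G` must grow at rate
`κ`. The points are moved inward by `e / 3` because the bounds hold only strictly inside. -/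
lemma GrowthCondition.sub_le {G : ℝ → ℝ} {β₁ β₂ κ : ℝ} (hG : Monotone G)
    (h : GrowthCondition G β₁ β₂ κ) (hκ : 0 < κ) {r s lo hi : ℝ} (hlo : ∀ t, r < t → lo ≤ G t)
    (hhi : ∀ t, t < s → G t ≤ hi) (h1 : β₁ < lo) (h2 : hi < β₂) (hle : lo ≤ hi) :
    s - r ≤ (hi - lo) / κ := by
  by_contra hc
  have hd : 0 ≤ (hi - lo) / κ := div_nonneg (sub_nonneg.2 hle) hκ.le
  set d := (hi - lo) / κ with hd_def
  set e := s - r - d with he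
  have hepos : 0 < e := by linarith [not_le.1 hc]
  have hlt : r + e / 3 < s - e / 3 := by linarith
  have ha := hlo (r + e / 3) (by linarith)
  have hb := hhi (s - e / 3) (by linarith)
  have hab := hG hlt.le
  have hl1 := hG.le_leftLim hlt
  have hl2 : Function.leftLim G (s - e / 3) ≤ G (s - e / 3) := hG.leftLim_le le_rfl
  have hg := h _ _ hlt ⟨by linarith, by linarith⟩ ⟨by linarith, by linarith⟩
  have hdk : d * κ = hi - lo := div_mul_cancel₀ _ hκ.ne'
  nlinarith

/-- Bounds for the estimated distribution functions on either side of `x₀` yield a bound for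
the plug-in quantiles at `x₀`. -/
lemma abs_plugIn_sub_le {n : ℕ} {x y : Fin n → ℝ} {S : Set ℝ} {F Q G q : ℝ → ℝ → ℝ} {x₀ : ℝ}
    (hF : IsDistributionFunction (F x₀)) (hQ : IsQuantileFamily S F Q) (hx₀ : x₀ ∈ S)
    (hx : ∀ i, x i ∈ S) (hG : IsDistributionEstimator x y G)
    {β₁ β₂ κ β D : ℝ} (hβ₁ : 0 ≤ β₁) (hβ₂ : β₂ ≤ 1) (hκ : 0 < κ) (hD : 0 ≤ D)
    (hgrowth : GrowthCondition (F x₀) β₁ β₂ κ) (hβ : β ∈ Ioo (β₁ + D) (β₂ - D))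
    (hmono : MonotoneOn (fun u => q u β) S)
    (hq : ∀ i, minQuantile (G (x i)) β ≤ q (x i) β ∧ q (x i) β ≤ maxQuantile (G (x i)) β)
    {k k' : Fin n} (hk : x k ≤ x₀) (hk' : x₀ ≤ x k')
    (hGk : ∀ t, G (x k) t ≤ F x₀ t + D) (hGk' : ∀ t, F x₀ t - D ≤ G (x k') t) :
    |q x₀ β - Q x₀ β| ≤ D / κ := by
  obtain ⟨hb1, hb2⟩ := hβ
  have hβ0 : 0 < β := by linarith
  have hβ1 : β < 1 := by linarith
  have hlow : minQuantile (G (x k)) β ≤ q x₀ β := (hq k).1.trans (hmono (hx k) hx₀ hk)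
  have hupp : q x₀ β ≤ maxQuantile (G (x k')) β := (hmono hx₀ (hx k') hk').trans (hq k').2
  obtain ⟨hQ1, hQ2⟩ := hQ.quantile x₀ hx₀ β ⟨hβ0, hβ1⟩
  -- Shrinking the range of `β` by `D` keeps `β + D` here, and `β - D` below, strictly between `β₁`
  -- and `β₂`. Only `F x₀` needs to be monotone in `t`, not the estimator.
  have hA := hgrowth.sub_le hF.mono hκ (r := Q x₀ β) (s := q x₀ β) (lo := β) (hi := β + D)
    (fun t ht => by
      obtain ⟨s, hst, hs⟩ := exists_lt_of_minQuantile_le (hF.nonempty hβ1) hQ1 ht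
      exact hs.trans (hF.mono hst.le))
    (fun t ht => by
      have := le_of_lt_of_le_maxQuantile (hG.bddBelow k' hβ0) hupp ht
      linarith [hGk' t])
    (by linarith) (by linarith) (by linarith)
  have hB := hgrowth.sub_le hF.mono hκ (r := q x₀ β) (s := Q x₀ β) (lo := β - D) (hi := β)
    (fun t ht => by
      obtain ⟨s, hst, hs⟩ := exists_lt_of_minQuantile_le (hG.nonempty k hβ1.le) hlow ht
      linarith [hGk s, hF.mono hst.le])
    (fun t ht => le_of_lt_of_le_maxQuantile (hF.bddBelow hβ0) hQ2 ht)
    (by linarith) (by linarith) (by linarith)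
  rw [add_sub_cancel_left] at hA
  rw [sub_sub_cancel] at hB
  exact abs_le.2 ⟨by linarith, hA⟩

end Quantiles

/-! ### Passing from fixed to random covariates. -/

section Disintegration

/-- The probability measure on `ℝ` with distribution function `G`. -/
lemma IsDistributionFunction.exists_measure {G : ℝ → ℝ} (hG : IsDistributionFunction G) :
    ∃ μ : Measure ℝ, IsProbabilityMeasure μ ∧ ∀ t, μ.real (Iic t) = G t := by
  let g : StieltjesFunction ℝ := ⟨G, hG.mono, hG.rightCont⟩
  refine ⟨g.measure, g.isProbabilityMeasure hG.atBot hG.atTop, fun t => ?_⟩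
  rw [measureReal_def, g.measure_Iic hG.atBot, sub_zero]
  exact ENNReal.toReal_ofReal (le_of_tendsto hG.atBot
    ((eventually_le_atBot t).mono fun s hs => hG.mono hs))

/-- A probability measure on `ι → ℝ` whose values on rational orthants factor is a product. -/
lemma eq_pi_of_real_Iic_rat {ι : Type*} [Fintype ι] (μ : ι → Measure ℝ)
    [∀ i, IsProbabilityMeasure (μ i)] (ν : Measure (ι → ℝ)) [IsProbabilityMeasure ν]
    (h : ∀ r : ι → ℚ, ν.real (Iic fun i => (r i : ℝ)) = ∏ i, (μ i).real (Iic (r i : ℝ))) :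
    Measure.pi μ = ν := by
  have hspan : ∀ i, (μ i).FiniteSpanningSetsIn (⋃ a : ℚ, {Iic (a : ℝ)}) := fun i =>
    { set := fun n => Iic ((n : ℚ) : ℝ)
      set_mem := fun n => mem_iUnion.2 ⟨n, rfl⟩
      finite := fun n => measure_lt_top _ _
      spanning := by
        refine eq_univ_of_forall fun a => ?_
        obtain ⟨n, hn⟩ := exists_nat_ge a
        exact mem_iUnion.2 ⟨n, by simpa using hn⟩ }
  refine Measure.pi_eq_generateFrom (C := fun _ => ⋃ a : ℚ, {Iic (a : ℝ)})
    (fun _ => ?_) (fun _ => Real.isPiSystem_Iic_rat) hspan fun s hs => ?_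
  · rw [← Real.borel_eq_generateFrom_Iic_rat]
    exact (BorelSpace.measurable_eq (α := ℝ)).symm
  · have hs' : ∀ i, ∃ r : ℚ, s i = Iic (r : ℝ) := fun i => by
      simpa [eq_comm] using hs i
    choose r hr using hs'
    obtain rfl : s = fun i => Iic (r i : ℝ) := funext hr
    rw [pi_univ_Iic]
    have h1 := h r
    simp only [measureReal_def] at h1
    rw [← ENNReal.toReal_prod] at h1
    exact (ENNReal.toReal_eq_toReal_iff' (measure_ne_top _ _)
      (ENNReal.prod_ne_top fun i _ => measure_ne_top _ _)).1 h1

variable {Ω : Type*} [MeasurableSpace Ω] {P : Measure Ω} [IsProbabilityMeasure P] {S : Set ℝ}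
  {F : ℝ → ℝ → ℝ} {n : ℕ} {X Y : Fin n → Ω → ℝ}

/-- Given the covariates, the response vector has a product distribution. -/
lemma IsSample.ae_condDistrib_eq_pi (h : IsSample P S F X Y) :
    ∀ᵐ ω ∂P, ∀ (μ : Fin n → Measure ℝ) [∀ i, IsProbabilityMeasure (μ i)],
      (∀ i t, (μ i).real (Iic t) = F (X i ω) t) →
      condDistrib (fun ω i => Y i ω) (fun ω i => X i ω) P (fun i => X i ω) = Measure.pi μ := by
  have hXm : Measurable fun ω i => X i ω := measurable_pi_lambda _ h.measX
  have hYm : Measurable fun ω i => Y i ω := measurable_pi_lambda _ h.measY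
  -- The conditional identities hold off a null set depending on the orthant; rational corners leave
  -- countably many to merge.
  have hae : ∀ᵐ ω ∂P, ∀ r : Fin n → ℚ,
      (condDistrib (fun ω i => Y i ω) (fun ω i => X i ω) P (fun i => X i ω)).real
        (Iic fun i => (r i : ℝ)) = ∏ i, F (X i ω) (r i) := by
    rw [ae_all_iff]
    intro r
    have h1 := condDistrib_ae_eq_condExp (μ := P) hXm hYm
      (s := Iic fun i => (r i : ℝ)) measurableSet_Iic
    have h2 := h.condIndep fun i => (r i : ℝ)
    have h3 : ∀ᵐ ω ∂P, ∀ i, condProbGiven P X {ω | Y i ω ≤ r i} ω = F (X i ω) (r i) :=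
      ae_all_iff.2 fun i => h.condDistr i (r i)
    filter_upwards [h1, h2, h3] with ω h1 h2 h3
    rw [h1]
    refine Eq.trans h2 (Finset.prod_congr rfl fun i _ => h3 i)
  filter_upwards [hae] with ω hω μ _ hμ
  refine (eq_pi_of_real_Iic_rat μ _ fun r => ?_).symm
  rw [hω r]
  exact Finset.prod_congr rfl fun i _ => (hμ i _).symm

/-- A bound valid conditionally on the covariates holds unconditionally. -/
lemma IsSample.measure_le (h : IsSample P S F X Y) (hF : IsStochasticallyOrdered S F)
    {W : Set ((Fin n → ℝ) × (Fin n → ℝ))} (hW : MeasurableSet W) {c : ENNReal}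
    (hc : ∀ x : Fin n → ℝ, (∀ i, x i ∈ S) → ∀ (μ : Fin n → Measure ℝ)
      [∀ i, IsProbabilityMeasure (μ i)], (∀ i t, (μ i).real (Iic t) = F (x i) t) →
      Measure.pi μ {y | (x, y) ∈ W} ≤ c) :
    P {ω | ((fun i => X i ω), fun i => Y i ω) ∈ W} ≤ c := by
  have hXm : Measurable fun ω i => X i ω := measurable_pi_lambda _ h.measX
  have hYm : Measurable fun ω i => Y i ω := measurable_pi_lambda _ h.measY
  have h1 : P {ω | ((fun i => X i ω), fun i => Y i ω) ∈ W} =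
      (P.map fun ω => ((fun i => X i ω), fun i => Y i ω)) W :=
    (Measure.map_apply (hXm.prodMk hYm) hW).symm
  rw [h1, ← compProd_map_condDistrib hYm.aemeasurable, Measure.compProd_apply hW,
    lintegral_map (Kernel.measurable_kernel_prodMk_left hW) hXm]
  calc _ ≤ ∫⁻ _, c ∂P := by
        refine lintegral_mono_ae ?_
        filter_upwards [h.ae_condDistrib_eq_pi] with ω hω
        choose μ hμp hμ using fun i => (hF.distr (X i ω) (h.memX i ω)).exists_measure
        rw [hω μ hμ]
        exact hc _ (fun i => h.memX i ω) μ hμ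
    _ = c := by simp

/-- Measurability in the covariate comes from monotonicity on `S`; the indicator discards the
arbitrary values of `F` outside `S`. -/
lemma IsStochasticallyOrdered.measurable_indicator (hF : IsStochasticallyOrdered S F)
    (hS : S.OrdConnected) (t : ℝ) : Measurable (S.indicator fun u => F u t) := by
  have hSm : MeasurableSet S := hS.measurableSet
  have := hS
  refine measurable_of_restrict_of_restrict_compl hSm ?_ ?_
  · have h : Antitone fun u : S => S.indicator (fun u => F u t) u := fun u v huv => by
      simpa [indicator_of_mem u.2, indicator_of_mem v.2] using hF.anti t u.2 v.2 huv
    exact h.measurable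
  · have h : (fun u : (Sᶜ : Set ℝ) => S.indicator (fun u => F u t) u) = fun _ => 0 :=
      funext fun u => indicator_of_notMem u.2 _
    have h0 : Measurable fun _ : (Sᶜ : Set ℝ) => (0 : ℝ) := measurable_const
    rw [← h] at h0
    exact h0

/-- The centred sums over some large block exceed `L` times the size of the block. -/
def noisySet (S : Set ℝ) (F : ℝ → ℝ → ℝ) (n : ℕ) (σ b m L : ℝ) :
    Set ((Fin n → ℝ) × (Fin n → ℝ)) :=
  {p | ∃ j, ∃ q : ℚ, m ≤ (block σ b p.1 j).card ∧ L * (block σ b p.1 j).card <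
    |centredSum (fun i t => S.indicator (fun u => F u t) (p.1 i)) (block σ b p.1 j) p.2 q|}

lemma measurableSet_noisySet (hF : IsStochasticallyOrdered S F) (hS : S.OrdConnected)
    (n : ℕ) (σ b m L : ℝ) : MeasurableSet (noisySet S F n σ b m L) := by
  have hX : ∀ i, Measurable fun p : (Fin n → ℝ) × (Fin n → ℝ) => p.1 i := fun i =>
    (measurable_pi_apply i).comp measurable_fst
  have hY : ∀ i, Measurable fun p : (Fin n → ℝ) × (Fin n → ℝ) => p.2 i := fun i =>
    (measurable_pi_apply i).comp measurable_snd
  have hmem : ∀ i j, MeasurableSet {p : (Fin n → ℝ) × (Fin n → ℝ) |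
      b ≤ σ * p.1 i ∧ σ * p.1 i ≤ σ * p.1 j} := fun i j =>
    (measurableSet_le measurable_const (measurable_const.mul (hX i))).inter
      (measurableSet_le (measurable_const.mul (hX i)) (measurable_const.mul (hX j)))
  have hcard : ∀ j, Measurable fun p : (Fin n → ℝ) × (Fin n → ℝ) =>
      ((block σ b p.1 j).card : ℝ) := by
    intro j
    simp only [block, Finset.card_filter, Nat.cast_sum]
    refine Finset.measurable_sum _ fun i _ => ?_
    simp only [Nat.cast_ite]
    exact Measurable.ite (hmem i j) measurable_const measurable_const
  have hsum : ∀ j, ∀ q : ℚ, Measurable fun p : (Fin n → ℝ) × (Fin n → ℝ) =>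
      centredSum (fun i t => S.indicator (fun u => F u t) (p.1 i)) (block σ b p.1 j) p.2 q := by
    intro j q
    simp only [centredSum, block, Finset.sum_filter]
    refine Finset.measurable_sum _ fun i _ => Measurable.ite (hmem i j) ?_ measurable_const
    exact ((measurable_const.indicator measurableSet_Iic).comp (hY i)).sub
      ((hF.measurable_indicator hS q).comp (hX i))
  unfold noisySet
  simp only [ofPred_exists]
  exact MeasurableSet.iUnion fun j => MeasurableSet.iUnion fun q =>
    (measurableSet_le measurable_const (hcard j)).inter
      (measurableSet_lt (measurable_const.mul (hcard j)) (hsum j q).abs)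

lemma IsSample.measure_noisySet_le (h : IsSample P S F X Y) (hF : IsStochasticallyOrdered S F)
    (hS : S.OrdConnected) (σ b : ℝ) {m L : ℝ} (hm : 0 < m) (hL : 0 < L)
    (hLm : 8 ≤ L ^ 2 * m) :
    P {ω | ((fun i => X i ω), fun i => Y i ω) ∈ noisySet S F n σ b m L} ≤
      ENNReal.ofReal (1024 / (L ^ 2 * m)) := by
  refine h.measure_le hF (measurableSet_noisySet hF hS n σ b m L) fun x hx μ _ hμ => ?_
  refine le_trans (measure_mono ?_) (pi_exists_centredSum_le μ
    (Finset.univ.filter fun i => b ≤ σ * x i) (fun i => σ * x i) hm hL hLm)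
  rintro y ⟨j, q, h1, h2⟩
  refine ⟨j, q, ?_⟩
  have hB : (Finset.univ.filter fun i => b ≤ σ * x i).filter (fun i => σ * x i ≤ σ * x j) =
      block σ b x j := by
    rw [Finset.filter_filter]; rfl
  have hp : (fun i t => (μ i).real (Iic t)) =
      fun i t => S.indicator (fun u => F u t) (x i) := by
    funext i t
    rw [hμ, indicator_of_mem (hx i)]
  rw [hB, hp]
  exact ⟨h1, h2⟩

lemma measurable_designCount {B : Set ℝ} (hB : MeasurableSet B) :
    Measurable fun x : Fin n → ℝ => (designCount x B : ℝ) := by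
  classical
  have : (fun x : Fin n → ℝ => (designCount x B : ℝ)) =
      fun x => ∑ i, B.indicator (fun _ => (1 : ℝ)) (x i) := by
    funext x
    have h1 : {i | x i ∈ B} = ((Finset.univ.filter fun i => x i ∈ B : Finset (Fin n)) : Set _) := by
      ext; simp
    rw [designCount, h1, ncard_coe_finset, Finset.card_filter]
    push_cast
    exact Finset.sum_congr rfl fun i _ => by simp [indicator_apply]
  rw [this]
  exact Finset.measurable_sum _ fun i _ =>
    (measurable_const.indicator hB).comp (measurable_pi_apply i)

end Disintegration

/-! ### Rates and the deterministic bound on the good event. -/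

section PointwiseRate

lemma designCount_Icc_eq {n : ℕ} (x : Fin n → ℝ) {σ b x₀ : ℝ}
    {B : Set ℝ} (hB : ∀ u, u ∈ B ↔ b ≤ σ * u ∧ σ * u ≤ σ * x₀) :
    designCount x B = Finset.card {i | b ≤ σ * x i ∧ σ * x i ≤ σ * x₀} := by
  rw [designCount, ← ncard_coe_finset]
  congr 1
  ext i
  simp [hB]

lemma pointRate_pos (α : ℝ) {n : ℕ} (hn : 0 < n) : 0 < pointRate α n :=
  Real.rpow_pos_of_pos (Nat.cast_pos.2 hn) _

lemma bandwidth_rpow {α C₃ : ℝ} (hC₃ : 0 < C₃) (n : ℕ) :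
    bandwidth α C₃ n ^ α = C₃ ^ α * pointRate α n := by
  unfold bandwidth pointRate
  rw [Real.mul_rpow hC₃.le (by positivity), ← Real.rpow_mul (by positivity)]
  congr 2
  ring

/-- The bias-variance balance: noise of order `(n δ) ^ (-1/2)` has the same order as the bias `δ ^
α`. -/
lemma mul_bandwidth {α : ℝ} (hα : 0 < α) (C₃ : ℝ) {n : ℕ} (hn : 0 < n) :
    n * bandwidth α C₃ n * pointRate α n ^ 2 = C₃ := by
  have hn' : (0 : ℝ) < n := Nat.cast_pos.2 hn
  unfold bandwidth pointRate
  rw [← Real.rpow_natCast, ← Real.rpow_mul hn'.le]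
  calc (n : ℝ) * (C₃ * (n : ℝ) ^ (-(1 / (2 * α + 1)))) *
        (n : ℝ) ^ (-(α / (2 * α + 1)) * ((2 : ℕ) : ℝ))
      = C₃ * ((n : ℝ) ^ (1 : ℝ) * (n : ℝ) ^ (-(1 / (2 * α + 1))) *
        (n : ℝ) ^ (-(α / (2 * α + 1)) * ((2 : ℕ) : ℝ))) := by rw [Real.rpow_one]; ring
    _ = C₃ * (n : ℝ) ^ (0 : ℝ) := by
        rw [← Real.rpow_add hn', ← Real.rpow_add hn']
        congr 2
        push_cast
        field_simp
        ring
    _ = C₃ := by rw [Real.rpow_zero, mul_one]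

lemma tendsto_bandwidth {α : ℝ} (hα : 0 < α) (C₃ : ℝ) :
    Tendsto (bandwidth α C₃) atTop (𝓝 0) := by
  have h := ((tendsto_rpow_neg_atTop (y := 1 / (2 * α + 1)) (by positivity)).comp
    tendsto_natCast_atTop_atTop).const_mul C₃
  rwa [mul_zero] at h

/-- On the event that the design is dense around `x₀` and the centred sums over large blocks
are small, the plug-in quantiles at `x₀` are close to the true ones. -/
lemma abs_plugIn_sub_le_of_notMem_noisySet {n : ℕ} {x y : Fin n → ℝ} {S : Set ℝ}
    {F Q q : ℝ → ℝ → ℝ} {x₀ δ α C₁ m L β₁ β₂ κ β : ℝ}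
    (hF : IsStochasticallyOrdered S F) (hQ : IsQuantileFamily S F Q) (hx₀ : x₀ ∈ S)
    (hx : ∀ i, x i ∈ S) (hq : IsPlugInQuantileEstimator S x y q)
    (hδ : 0 < δ) (hC₁ : 0 < C₁) (hm : 0 < m) (hL : 0 ≤ L)
    (hl : x₀ - δ ∈ S) (hr : x₀ + δ ∈ S)
    (hFl : ∀ t, |F (x₀ - δ) t - F x₀ t| ≤ C₁ * δ ^ α)
    (hFr : ∀ t, |F (x₀ + δ) t - F x₀ t| ≤ C₁ * δ ^ α)
    (hcl : m ≤ designCount x (Icc (x₀ - δ) x₀)) (hcr : m ≤ designCount x (Icc x₀ (x₀ + δ)))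
    (hnl : (x, y) ∉ noisySet S F n 1 (x₀ - δ) m L)
    (hnr : (x, y) ∉ noisySet S F n (-1) (-(x₀ + δ)) m L)
    (hβ₁ : 0 ≤ β₁) (hβ₂ : β₂ ≤ 1) (hκ : 0 < κ) (hgrowth : GrowthCondition (F x₀) β₁ β₂ κ)
    (hβ : β ∈ Ioo (β₁ + (C₁ * δ ^ α + L)) (β₂ - (C₁ * δ ^ α + L))) :
    |q x₀ β - Q x₀ β| ≤ (C₁ * δ ^ α + L) / κ := by
  obtain ⟨G, hG, hqG⟩ := hq
  have hD : 0 ≤ C₁ * δ ^ α := by positivity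
  have hnoise : ∀ σ b, (x, y) ∉ noisySet S F n σ b m L → ∀ j, m ≤ (block σ b x j).card → ∀ t,
      |centredSum (fun i => F (x i)) (block σ b x j) y t| ≤ L * (block σ b x j).card := by
    intro σ b hn j hj
    refine centredSum_le_of_rat _ (fun i => (hF.distr _ (hx i)).rightCont) _ _ fun r => ?_
    by_contra hc
    refine hn ⟨j, r, hj, ?_⟩
    have hp : (fun i t => S.indicator (fun u => F u t) (x i)) = fun i => F (x i) := by
      funext i t
      rw [indicator_of_mem (hx i)]
    simp only [hp]
    exact not_le.1 hc
  rw [designCount_Icc_eq x (σ := 1) (b := x₀ - δ) (x₀ := x₀) (by simp)] at hcl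
  rw [designCount_Icc_eq x (σ := -1) (b := -(x₀ + δ)) (x₀ := x₀) (fun u => by
    constructor <;> rintro ⟨h1, h2⟩ <;> constructor <;> linarith)] at hcr
  obtain ⟨k, hk, hGk⟩ := hG.exists_bound hF hx (Or.inl rfl) (by rwa [one_mul]) hm hcl
    (hnoise _ _ hnl)
  obtain ⟨k', hk', hGk'⟩ := hG.exists_bound hF hx (Or.inr rfl)
    (by rwa [neg_one_mul, neg_neg]) hm hcr (hnoise _ _ hnr)
  rw [one_mul, one_mul] at hk
  simp only [one_mul] at hGk
  simp only [neg_one_mul, neg_neg] at hGk'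
  have hβ01 : β ∈ Ioo (0 : ℝ) 1 := ⟨by linarith [hβ.1], by linarith [hβ.2]⟩
  refine abs_plugIn_sub_le (hF.distr x₀ hx₀) hQ hx₀ hx hG hβ₁ hβ₂ hκ (by positivity) hgrowth hβ
    (hqG β hβ01).1 (hqG β hβ01).2 hk (by linarith : x₀ ≤ x k') (fun t => ?_) (fun t => ?_)
  · linarith [hGk t, (abs_le.1 (hFl t)).2]
  · linarith [hGk' t, (abs_le.1 (hFr t)).1]

end PointwiseRate

/-! ### Choice of constants and the union bound. -/

theorem theorem4 {Ω : ℕ → Type*} [∀ n, MeasurableSpace (Ω n)]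
    (P : ∀ n, Measure (Ω n)) [∀ n, IsProbabilityMeasure (P n)]
    (S : Set ℝ) (hS : S.OrdConnected) (x₀ : ℝ) (hx₀ : x₀ ∈ interior S)
    (F Q : ℝ → ℝ → ℝ) (hF : IsStochasticallyOrdered S F) (hQ : IsQuantileFamily S F Q)
    (X Y : ∀ n, Fin n → Ω n → ℝ) (hXY : ∀ n, 2 ≤ n → IsSample (P n) S F (X n) (Y n))
    (α C₁ C₂ C₃ : ℝ) (hα : α ∈ Ioc (0 : ℝ) 1) (hC₁ : 0 < C₁) (hC₂ : 0 < C₂) (hC₃ : 0 < C₃)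
    (hA1 : HolderAtPoint S F x₀ α C₁)
    (hA2 : DenseDesignAtPoint P X x₀ α C₂ C₃)
    (β₁ β₂ κ : ℝ) (hβ₁ : 0 ≤ β₁) (hβ : β₁ < β₂) (hβ₂ : β₂ ≤ 1) (hκ : 0 < κ)
    (hA3 : GrowthCondition (F x₀) β₁ β₂ κ)
    (Qhat : ∀ n, Ω n → ℝ → ℝ → ℝ)
    (hQhat : ∀ n, 2 ≤ n → ∀ ω,
      IsPlugInQuantileEstimator S (fun i => X n i ω) (fun i => Y n i ω) (Qhat n ω)) :
    ∀ ε : ℝ, 0 < ε → ∃ C : ℝ, 0 < C ∧ ∃ M : ℝ, 0 < M ∧ ∃ N : ℕ, ∀ n : ℕ, N ≤ n →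
      P n {ω | ∃ β ∈ Ioo (β₁ + C * pointRate α n) (β₂ - C * pointRate α n),
          M * pointRate α n < |Qhat n ω x₀ β - Q x₀ β|}
        ≤ ENNReal.ofReal ε := by
  intro ε hε
  obtain ⟨U, hU, hUS, hHolder⟩ := hA1
  -- With `L = K r`, this gives `L ^ 2 * m = 8 + 4096 / ε`: the `8` permits symmetrization, and
  -- `4096 / ε` brings `1024 / (L ^ 2 * m)` below `ε / 4`. In `C`, the first summand is the bias and
  -- `K` the noise.
  set K : ℝ := √((8 + 4096 / ε) / (C₂ * C₃)) with hK
  have hKpos : 0 < K := Real.sqrt_pos.2 (by positivity)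
  have hKsq : K ^ 2 * (C₂ * C₃) = 8 + 4096 / ε := by
    rw [hK, Real.sq_sqrt (by positivity), div_mul_cancel₀ _ (by positivity)]
  set C : ℝ := C₁ * C₃ ^ α + K with hC
  have hCpos : 0 < C := by positivity
  refine ⟨C, hCpos, C / κ, by positivity, ?_⟩
  have hδ0 := tendsto_bandwidth hα.1 C₃
  have hleft : ∀ᶠ n in atTop, x₀ - bandwidth α C₃ n ∈ U := by
    have h := hδ0.const_sub x₀
    rw [sub_zero] at h
    exact h hU
  have hright : ∀ᶠ n in atTop, x₀ + bandwidth α C₃ n ∈ U := by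
    have h := hδ0.const_add x₀
    rw [add_zero] at h
    exact h hU
  have hdense := hA2.eventually (lt_mem_nhds (show 1 - ENNReal.ofReal (ε / 2) < 1 from
    ENNReal.sub_lt_self ENNReal.one_ne_top one_ne_zero
      (ENNReal.ofReal_pos.2 (by positivity)).ne'))
  rw [← eventually_atTop]
  filter_upwards [hleft, hright, hdense, eventually_ge_atTop 2] with n hl hr hd hn
  have hn0 : 0 < n := by omega
  have hn0' : (0 : ℝ) < n := Nat.cast_pos.2 hn0
  set r := pointRate α n with hrdef
  set δ := bandwidth α C₃ n with hδdef
  have hrpos : 0 < r := pointRate_pos α hn0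
  have hδpos : 0 < δ := mul_pos hC₃ (Real.rpow_pos_of_pos hn0' _)
  have hδα : δ ^ α = C₃ ^ α * r := bandwidth_rpow hC₃ n
  have hnδ : n * δ * r ^ 2 = C₃ := mul_bandwidth hα.1 C₃ hn0
  have hsample := hXY n hn
  set m : ℝ := C₂ * (n * δ) with hm
  have hmpos : 0 < m := by positivity
  have hLm : (K * r) ^ 2 * m = 8 + 4096 / ε := by
    rw [← hKsq, ← hnδ, hm]; ring
  have hDC : C₁ * δ ^ α + K * r = C * r := by rw [hδα, hC]; ring
  have hnoise : ∀ σ b, P n {ω | ((fun i => X n i ω), fun i => Y n i ω) ∈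
      noisySet S F n σ b m (K * r)} ≤ ENNReal.ofReal (ε / 4) := by
    intro σ b
    refine (hsample.measure_noisySet_le hF hS σ b hmpos (by positivity) ?_).trans
      (ENNReal.ofReal_le_ofReal ?_)
    · rw [hLm]
      linarith [show 0 < 4096 / ε by positivity]
    · rw [hLm, div_le_iff₀ (by positivity)]
      have : ε / 4 * (8 + 4096 / ε) = 2 * ε + 1024 := by field_simp; ring
      linarith
  set A : Set (Ω n) := {ω |
      C₂ ≤ designCount (fun i => X n i ω) (Icc (x₀ - δ) x₀) / (n * δ) ∧
      C₂ ≤ designCount (fun i => X n i ω) (Icc x₀ (x₀ + δ)) / (n * δ)} with hA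
  have hXm : Measurable fun ω i => X n i ω := measurable_pi_lambda _ hsample.measX
  have hAm : MeasurableSet A :=
    (measurableSet_le measurable_const
      (((measurable_designCount measurableSet_Icc).comp hXm).div_const _)).inter
    (measurableSet_le measurable_const
      (((measurable_designCount measurableSet_Icc).comp hXm).div_const _))
  have hAc : P n Aᶜ ≤ ENNReal.ofReal (ε / 2) := by
    rw [prob_compl_eq_one_sub hAm]
    exact tsub_le_iff_left.2 (tsub_le_iff_right.1 hd.le)
  -- The exceptional set need not be measurable; covering it by three events bounds its outer
  -- measure.
  have hsub : {ω | ∃ β ∈ Ioo (β₁ + C * r) (β₂ - C * r),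
      C / κ * r < |Qhat n ω x₀ β - Q x₀ β|} ⊆
      (Aᶜ ∪ {ω | ((fun i => X n i ω), fun i => Y n i ω) ∈
        noisySet S F n 1 (x₀ - δ) m (K * r)}) ∪
      {ω | ((fun i => X n i ω), fun i => Y n i ω) ∈
        noisySet S F n (-1) (-(x₀ + δ)) m (K * r)} := by
    rintro ω ⟨β, hβmem, hlt⟩
    by_contra hω
    simp only [mem_union, not_or, mem_compl_iff, not_not] at hω
    obtain ⟨⟨hωA, hω1⟩, hω2⟩ := hω
    have hnδpos : 0 < n * δ := by positivity
    have hle := abs_plugIn_sub_le_of_notMem_noisySet hF hQ (interior_subset hx₀)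
      (fun i => hsample.memX i ω) (hQhat n hn ω) hδpos hC₁ hmpos (by positivity)
      (hUS hl) (hUS hr)
      (fun t => by
        have := hHolder _ hl t
        rwa [sub_sub_cancel_left, abs_neg, abs_of_pos hδpos] at this)
      (fun t => by
        have := hHolder _ hr t
        rwa [add_sub_cancel_left, abs_of_pos hδpos] at this)
      ((le_div_iff₀ hnδpos).1 hωA.1) ((le_div_iff₀ hnδpos).1 hωA.2) hω1 hω2
      hβ₁ hβ₂ hκ hA3 (by rw [hDC]; exact hβmem)
    rw [hDC, mul_div_right_comm] at hle
    exact absurd hlt (not_lt.2 hle)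
  calc _ ≤ _ := measure_mono hsub
    _ ≤ ENNReal.ofReal (ε / 2) + ENNReal.ofReal (ε / 4) + ENNReal.ofReal (ε / 4) :=
        (measure_union_le _ _).trans (add_le_add ((measure_union_le _ _).trans
          (add_le_add hAc (hnoise _ _))) (hnoise _ _))
    _ = ENNReal.ofReal ε := by
        rw [← ENNReal.ofReal_add (by positivity) (by positivity),
          ← ENNReal.ofReal_add (by positivity) (by positivity)]
        congr 1
        ring
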